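/- For a finite graph, hypergraph or directed (multi)graph $Q$, the bunkbed structure $\tilde Q$ consists of two disjoint copies $Q_0,Q_1$ of $Q$ (the copies in $Q_i$ of a vertex $v$ and an edge $e$ are written $v^{(i)},e^{(i)}$), together with a vertical edge between $v^{(0)}$ and $v^{(1)}$ for every $v\in V(Q)$ (bidirectional if $Q$ is directed). A percolation model selects a random set of edges of $\tilde Q$, which are retained; write $P(x\to y)$ for the probability that there is a (directed, if $Q$ is directed) path of retained edges from $x$ to $y$. In a hypergraph, consecutive vertices of a path lie in a common hyperedge. The bunkbed conjecture for a model states that $P(u^{(0)}\to v^{(0)})\ge P(u^{(0)}\to v^{(1)})$ for all $Q$ and all $u,v\in V(Q)$. Consider the following models. - $E_1$ (graphs $G$): a set $W\subseteq V(\tilde G)$ is chosen uniformly among all subsets, and the edges with both ends in $W$ are retained. - $E_2^T$ (graphs $G$, $T\subseteq V(G)$): as $E_1$, but $W$ is uniform among the sets containing both $v^{(0)},v^{(1)}$ for $v\in T$ and exactly one of them for $v\notin T$. - $E_4^T$ (hypergraphs $\mathcal H$, $T\subseteq V(\mathcal H)$): the retained set is uniform among those containing exactly one of $e^{(0)},e^{(1)}$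 for each hyperedge $e$, and exactly the vertical edges at the vertices of $T$. - $E_5$ (hypergraphs): the retained set is uniform among all subsets of $E(\tilde{\mathcal H})$. - $E_6^{T,F}$ (digraphs $D$, $T\subseteq V(D)$, $F\subseteq E(D)$): the retained set is uniform among those containing both $e^{(0)},e^{(1)}$ for $e\in F$, exactly one of them for $e\notin F$, and exactly the vertical edges at the vertices of $T$. - $E_7$ (directed multigraphs): the retained set is uniform among all subsets of $E(\tilde D)$. **Theorem 1.** The bunkbed conjecture is false for each of the models $E_1$, $E_2^T$, $E_4^T$, $E_5$, $E_6^{T,F}$ and $E_7$. More precisely, $P(u^{(0)}\to v^{(1)})>P(u^{(0)}\to v^{(0)})$ in each of the following cases. 1. $E_2^{T_2}$ on $G_2$, with $u=v_1$, $v=v_9$. Here $G_2$ is the graph on $v_1,\dots,v_9$ with edges $v_1v_5$, $v_5v_4$, $v_4v_3$, $v_3v_6$, $v_6v_9$, $v_1v_2$, $v_3v_2$, $v_4v_7$, $v_6v_7$, $v_5v_8$, $v_9v_8$, and $T_2=\{v_2,v_7,v_8\}$. 2. $E_1$ on the graph $G_1$ with 105 vertices that is obtained from $G_2$ by blowing up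 each of $v_2,v_7,v_8$ to an independent set of 33 vertices, with $u=v_1$, $v=v_9$. 3. $E_4^{T_4}$ on $\mathcal H_4$, with $u=u_1$, $v=u_{10}$. Here $\mathcal H_4$ is the hypergraph on $u_1,\dots,u_{10}$ with hyperedges $u_1u_2u_3$, $u_3u_4u_9$, $u_4u_5u_7$, $u_5u_6u_2$, $u_6u_8u_7$, $u_8u_{10}u_9$, and $T_4=\{u_2,u_7,u_9\}$. 4. $E_5$ on the hypergraph $\mathcal H_5$ with 316 vertices that is obtained from $\mathcal H_4$ by attaching 102 pendant 2-edges at each vertex of $T_4$, with $u=u_1$, $v=u_{10}$. 5. $E_6^{T_6,F_6}$ on $D_6$, with $u=u_1$, $v=u_{10}$. Here $D_6$ is the digraph obtained from $\mathcal H_4$ by replacing each hyperedge $f$ by two new vertices $x_f,y_f$, the directed edge $x_fy_f$, and the directed edges $ax_f$, $y_fa$ for each $a\in f$; $T_6=T_4$, and $F_6$ consists of all edges of $D_6$ other than the edges $x_fy_f$. 6. $E_7$ on the directed multigraph $D_7$ with 2092 vertices that is obtained from $D_6$ by replacing each edge in $F_6$ by 690 parallel edges, and attaching to each $t\in T_6$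 new vertices $w_{t,1},\dots,w_{t,690}$ with the directed edges $t\,w_{t,j}$ and $w_{t,j}\,t$; with $u=u_1$, $v=u_{10}$. -/

import Mathlib

namespace Bunkbed

/-- Common setting for graphs, hypergraphs and (multi-)digraphs as far as paths are concerned:
a type of edges, and `Joins e x y` says that the edge `e` may be used to step from `x` to `y`. -/
structure Net (V : Type) where
  Edge : Type
  Joins : Edge → V → V → Prop

/-- A directed multigraph with vertex type `V` and edge type `E`. -/
structure MultiDigraph (V E : Type) where
  src : E → V
  tgt : E → V

/-- The set of (directed) edges of a digraph, as a type. -/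
abbrev DEdge {V : Type} (D : Digraph V) : Type := {p : V × V // D.Adj p.1 p.2}

/-- A graph: an edge may be traversed between its two ends, in both directions. -/
def ofGraph {V : Type} (G : SimpleGraph V) : Net V where
  Edge := G.edgeSet
  Joins e x y := e.1 = s(x, y)

/-- A hypergraph: consecutive vertices of a path are members of a common hyperedge. -/
def ofHypergraph {α : Type} (H : Hypergraph α) : Net H.vertexSet where
  Edge := H.edgeSet
  Joins e x y := x.1 ∈ e.1 ∧ y.1 ∈ e.1

/-- A digraph: edges are traversed from tail to head. -/
def ofDigraph {V : Type} (D : Digraph V) : Net V where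
  Edge := DEdge D
  Joins e x y := e.1 = (x, y)

/-- A directed multigraph: edges are traversed from tail to head. -/
def ofMultiDigraph {V E : Type} (D : MultiDigraph V E) : Net V where
  Edge := E
  Joins e x y := D.src e = x ∧ D.tgt e = y

/-- The edges of the bunkbed structure: `Sum.inl (e, i)` is the horizontal edge `e⁽ⁱ⁾`, and
`Sum.inr v` is the vertical edge between `v⁽⁰⁾` and `v⁽¹⁾`. -/
abbrev BEdge {V : Type} (Q : Net V) : Type := (Q.Edge × Fin 2) ⊕ V

/-- The bunkbed structure over `Q`; the vertex `v⁽ⁱ⁾` is `(v, i)`. Vertical edges can be traversed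
in both directions. -/
def bunkbed {V : Type} (Q : Net V) : Net (V × Fin 2) where
  Edge := BEdge Q
  Joins e x y :=
    match e with
    | Sum.inl (e, i) => x.2 = i ∧ y.2 = i ∧ Q.Joins e x.1 y.1
    | Sum.inr v => x.1 = v ∧ y.1 = v ∧ x.2 ≠ y.2

/-- There is a path from `x` to `y` in `N` all of whose edges belong to `X`. -/
def Conn {V : Type} (N : Net V) (X : Set N.Edge) (x y : V) : Prop :=
  Relation.ReflTransGen (fun a b => ∃ e ∈ X, N.Joins e a b) x y

/-- The two ends of an edge (for graphs), or the members of a hyperedge. -/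
def ends {V : Type} (N : Net V) (e : N.Edge) : Set V :=
  {x | ∃ y, N.Joins e x y ∨ N.Joins e y x}

/-- A percolation model: an element of the finite family `outcomes` is chosen uniformly at
random, and it determines the set of retained edges. For bond percolation the outcomes are sets
of edges, for site percolation they are sets of open vertices. -/
structure Model {V : Type} (N : Net V) where
  Outcome : Type
  outcomes : Set Outcome
  retained : Outcome → Set N.Edge

/-- The probability, under the uniform distribution on the family `outcomes`, that there is a
path of retained edges from `x` to `y`. -/
noncomputable def Model.prob {V : Type} {N : Net V} (M : Model N) (x y : V) : ℚ :=
  (Set.ncard {ω ∈ M.outcomes | Conn N (M.retained ω) x y} : ℚ) / (Set.ncard M.outcomes : ℚ)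

/-- The bunkbed conjecture for a given model on a given `Q`. -/
def BunkbedConjecture {V : Type} {Q : Net V} (M : Model (bunkbed Q)) : Prop :=
  ∀ u v : V, M.prob (u, 0) (v, 0) ≥ M.prob (u, 0) (v, 1)

/-! ### The models -/

/-- Site percolation: the outcomes are sets of open vertices, and precisely the edges with both
ends open are retained. -/
def siteModel {V : Type} (G : SimpleGraph V) (𝒲 : Set (Set (V × Fin 2))) :
    Model (bunkbed (ofGraph G)) where
  Outcome := Set (V × Fin 2)
  outcomes := 𝒲
  retained W := {e | ends (bunkbed (ofGraph G)) e ⊆ W}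

/-- Bond percolation: the outcomes are the sets of retained edges. -/
def bondModel {V : Type} (Q : Net V) (𝓔 : Set (Set (BEdge Q))) : Model (bunkbed Q) where
  Outcome := Set (BEdge Q)
  outcomes := 𝓔
  retained X := X

/-- Unconditioned site percolation: all sets of open vertices are allowed. -/
def E1 {V : Type} (G : SimpleGraph V) : Model (bunkbed (ofGraph G)) :=
  siteModel G Set.univ

/-- Conditioned site percolation: both copies of each `v ∈ T` are open, and precisely one copy of
each `v ∉ T` is open. -/
def E2 {V : Type} (G : SimpleGraph V) (T : Set V) : Model (bunkbed (ofGraph G)) :=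
  siteModel G {W | ∀ v, (v ∈ T → (v, 0) ∈ W ∧ (v, 1) ∈ W) ∧
    (v ∉ T → Xor ((v, 0) ∈ W) ((v, 1) ∈ W))}

/-- Conditioned hypergraphs: precisely one copy of each hyperedge is retained, and the retained
vertical edges are those at `T`. -/
def E4 {α : Type} (H : Hypergraph α) (T : Set H.vertexSet) : Model (bunkbed (ofHypergraph H)) :=
  bondModel (ofHypergraph H) {X |
    (∀ e : H.edgeSet, Xor (Sum.inl (e, 0) ∈ X) (Sum.inl (e, 1) ∈ X)) ∧
    (∀ v, Sum.inr v ∈ X ↔ v ∈ T)}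

/-- Unconditioned hypergraphs. -/
def E5 {α : Type} (H : Hypergraph α) : Model (bunkbed (ofHypergraph H)) :=
  bondModel (ofHypergraph H) Set.univ

/-- Conditioned digraphs: both copies of each `e ∈ F` and precisely one copy of each edge `e ∉ F`
are retained, and the retained vertical edges are those at `T`. -/
def E6 {V : Type} (D : Digraph V) (T : Set V) (F : Set (DEdge D)) :
    Model (bunkbed (ofDigraph D)) :=
  bondModel (ofDigraph D) {X |
    (∀ e : DEdge D, (e ∈ F → Sum.inl (e, 0) ∈ X ∧ Sum.inl (e, 1) ∈ X) ∧
      (e ∉ F → Xor (Sum.inl (e, 0) ∈ X) (Sum.inl (e, 1) ∈ X))) ∧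
    (∀ v, Sum.inr v ∈ X ↔ v ∈ T)}

/-- Unconditioned directed multigraphs. -/
def E7 {V E : Type} (D : MultiDigraph V E) : Model (bunkbed (ofMultiDigraph D)) :=
  bondModel (ofMultiDigraph D) Set.univ

/-! ### The counterexamples -/

/-- The graph `G₂`; the vertex `v_j` is `j - 1 : Fin 9`. The vertices outside `T2` induce the path
`v₁ v₅ v₄ v₃ v₆ v₉`, and each of them has one neighbour in `T2`. -/
def G2 : SimpleGraph (Fin 9) :=
  SimpleGraph.fromEdgeSet
    {s(0, 4), s(4, 3), s(3, 2), s(2, 5), s(5, 8),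
      s(0, 1), s(2, 1), s(3, 6), s(5, 6), s(4, 7), s(8, 7)}

/-- `T₂ = {v₂, v₇, v₈}`. -/
def T2 : Set (Fin 9) := {1, 6, 7}

/-- The vertices of the blow-up of the vertices in `T` to `k` vertices each. -/
abbrev BlowUpVertex {V : Type} (T : Set V) (k : ℕ) : Type := (Tᶜ : Set V) ⊕ (T × Fin k)

/-- The vertex from which a vertex of the blow-up arises. -/
def blowUpProj {V : Type} (T : Set V) (k : ℕ) : BlowUpVertex T k → V
  | Sum.inl v => v.1
  | Sum.inr p => p.1.1

/-- The blow-up of each vertex in `T` to an empty graph on `k` vertices. -/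
def blowUp {V : Type} (G : SimpleGraph V) (T : Set V) (k : ℕ) : SimpleGraph (BlowUpVertex T k) :=
  G.comap (blowUpProj T k)

/-- The graph `G₁`. -/
def G1 : SimpleGraph (BlowUpVertex T2 33) := blowUp G2 T2 33

/-- The vertex `v₁` of `G₁`. -/
def G1start : BlowUpVertex T2 33 := Sum.inl ⟨0, by simp [T2]⟩

/-- The vertex `v₉` of `G₁`. -/
def G1target : BlowUpVertex T2 33 := Sum.inl ⟨8, by simp [T2]⟩

/-- The 3-uniform hypergraph `H₄`; the vertex `u_j` is `j - 1 : Fin 10`. The hyperedges correspond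
to `v₁, v₅, v₄, v₃, v₆, v₉` in this order. -/
def H4 : Hypergraph (Fin 10) where
  vertexSet := Set.univ
  edgeSet := {{0, 1, 2}, {2, 3, 8}, {3, 4, 6}, {4, 5, 1}, {5, 7, 6}, {7, 9, 8}}
  subset_vertexSet_of_mem_edgeSet' := fun _ _ => Set.subset_univ _

/-- `T₄ = {u₂, u₇, u₉}`, as a set of elements of `Fin 10`. -/
def T4 : Set (Fin 10) := {1, 6, 8}

/-- The hypergraph `H₅`: `H₄` with `k = 102` pendant 2-edges attached at each vertex of `T₄`. -/
def H5 : Hypergraph (Fin 10 ⊕ (T4 × Fin 102)) where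
  vertexSet := Set.univ
  edgeSet := {e | ∃ f ∈ H4.edgeSet, e = Sum.inl '' f} ∪
    {e | ∃ (t : T4) (i : Fin 102), e = {Sum.inl t.1, Sum.inr (t, i)}}
  subset_vertexSet_of_mem_edgeSet' := fun _ _ => Set.subset_univ _

/-- The vertices of `D₆`: those of `H₄`, and new vertices `x_f`, `y_f` for each hyperedge `f`. -/
inductive D6Vertex : Type
  | old (u : Fin 10)
  | x (f : H4.edgeSet)
  | y (f : H4.edgeSet)

/-- The directed edges of `D₆`: `u x_f` and `y_f u` for `u ∈ f`, and `x_f y_f`. -/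
inductive D6Adj : D6Vertex → D6Vertex → Prop
  | enter (u : Fin 10) (f : H4.edgeSet) : u ∈ f.1 → D6Adj (.old u) (.x f)
  | middle (f : H4.edgeSet) : D6Adj (.x f) (.y f)
  | leave (u : Fin 10) (f : H4.edgeSet) : u ∈ f.1 → D6Adj (.y f) (.old u)

/-- The digraph `D₆`. -/
def D6 : Digraph D6Vertex where
  Adj := D6Adj

/-- `T₆`, the copy of `T₄` in `D₆`. -/
def T6 : Set D6Vertex := D6Vertex.old '' T4

/-- `F₆`, the edges of `D₆` other than the edges `x_f y_f`. -/
def F6 : Set (DEdge D6) := {e | ∀ f, e.1 ≠ (D6Vertex.x f, D6Vertex.y f)}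

/-- The vertices of `attachGadgets D T F k`. -/
abbrev GadgetVertex {V : Type} (T : Set V) (k : ℕ) : Type := V ⊕ (T × Fin k)

/-- The edges of `attachGadgets D T F k`. -/
abbrev GadgetEdge {V : Type} (D : Digraph V) (T : Set V) (F : Set (DEdge D)) (k : ℕ) : Type :=
  ((Fᶜ : Set (DEdge D)) ⊕ (F × Fin k)) ⊕ ((T × Fin k) ⊕ (T × Fin k))

/-- Replace each edge in `F` by `k` parallel edges, keep the other edges of `D`, and attach to
each `t ∈ T` new vertices `w_{t,j}`, for `j ∈ Fin k`, with directed edges `t w_{t,j}` and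
`w_{t,j} t`. -/
def attachGadgets {V : Type} (D : Digraph V) (T : Set V) (F : Set (DEdge D)) (k : ℕ) :
    MultiDigraph (GadgetVertex T k) (GadgetEdge D T F k) where
  src
    | Sum.inl (Sum.inl e) => Sum.inl e.1.1.1
    | Sum.inl (Sum.inr p) => Sum.inl p.1.1.1.1
    | Sum.inr (Sum.inl p) => Sum.inl p.1.1
    | Sum.inr (Sum.inr p) => Sum.inr p
  tgt
    | Sum.inl (Sum.inl e) => Sum.inl e.1.1.2
    | Sum.inl (Sum.inr p) => Sum.inl p.1.1.1.2
    | Sum.inr (Sum.inl p) => Sum.inr p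
    | Sum.inr (Sum.inr p) => Sum.inl p.1.1

/-- The directed multigraph `D₇`. -/
def D7 : MultiDigraph (GadgetVertex T6 690) (GadgetEdge D6 T6 F6 690) :=
  attachGadgets D6 T6 F6 690

/-- The vertex `u` of `H₄`. -/
def H4vertex (u : Fin 10) : H4.vertexSet := ⟨u, Set.mem_univ u⟩

/-- The vertex of `H₅` which is the copy of the vertex `u` of `H₄`. -/
def H5vertex (u : Fin 10) : H5.vertexSet := ⟨Sum.inl u, Set.mem_univ _⟩

end Bunkbed

/-!
All the examples are encodings of one chain of six cells, which form a path from `u₁` to `u₁₀` and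
each of which contains one of three posts, where a walker can always change the layer. Say that a
configuration has a cut if there is a vertical edge on the path, or a cell which is open in both
layers or in none. Exchanging the layers of everything behind the cut is an involution which turns
the configurations connecting `u₁` in layer 0 to `u₁₀` in layer 0 into ones connecting it to `u₁₀`
in layer 1. Hence only the `2 ^ 18` configurations without cuts matter, and a computation, done for
all of them at once with the bits of large numbers, shows that layer 1 wins there by a few
configurations.

In the unconditioned models the edges that have to be retained are replaced by many gadgets, each of
which does the same job when all its parts are retained. The probability that all gadgets fail in
some place is too small to make up for the advantage of layer 1.
-/

namespace Bunkbed

/-! ### Uniform probabilities and random sets -/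

section UniformProb

variable {α β : Type*} {𝒮 : Set α} {P Q : α → Prop}

/-- The probability of the event `P` for an outcome chosen uniformly from `𝒮`; it is `0` if `𝒮` is
infinite or empty. -/
noncomputable def uniformProb (𝒮 : Set α) (P : α → Prop) : ℚ :=
  ({ω ∈ 𝒮 | P ω}.ncard : ℚ) / 𝒮.ncard

theorem uniformProb_eq_of_bijOn {𝒯 : Set β} {f : α → β} {Q : β → Prop} (hf : Set.BijOn f 𝒮 𝒯)
    (h : ∀ ω ∈ 𝒮, P ω ↔ Q (f ω)) : uniformProb 𝒮 P = uniformProb 𝒯 Q := by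
  have himage : {τ ∈ 𝒯 | Q τ} = f '' {ω ∈ 𝒮 | P ω} := by
    ext τ
    constructor
    · rintro ⟨hτ, hQ⟩
      obtain ⟨ω, hω, rfl⟩ := hf.surjOn hτ
      exact ⟨ω, ⟨hω, (h ω hω).2 hQ⟩, rfl⟩
    · rintro ⟨ω, ⟨hω, hP⟩, rfl⟩
      exact ⟨hf.mapsTo hω, (h ω hω).1 hP⟩
  rw [uniformProb, uniformProb, himage, ← hf.image_eq, hf.injOn.ncard_image,
    (hf.injOn.mono (Set.sep_subset _ _)).ncard_image]

theorem uniformProb_mono [Finite α] (h : ∀ ω ∈ 𝒮, P ω → Q ω) :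
    uniformProb 𝒮 P ≤ uniformProb 𝒮 Q := by
  unfold uniformProb
  gcongr
  · exact Set.toFinite _
  · exact h _ ‹_›

theorem uniformProb_or_le : uniformProb 𝒮 (fun ω => P ω ∨ Q ω) ≤
    uniformProb 𝒮 P + uniformProb 𝒮 Q := by
  unfold uniformProb
  rw [← add_div, ← Nat.cast_add]
  gcongr
  rw [Set.sep_or]
  exact Set.ncard_union_le _ _

theorem uniformProb_exists_le {ι : Type*} [Fintype ι] (P : ι → α → Prop) :
    uniformProb 𝒮 (fun ω => ∃ i, P i ω) ≤ ∑ i, uniformProb 𝒮 (P i) := by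
  unfold uniformProb
  rw [← Finset.sum_div, ← Nat.cast_sum]
  gcongr
  have hunion : {ω ∈ 𝒮 | ∃ i, P i ω} = ⋃ i, {ω ∈ 𝒮 | P i ω} := by ext; simp
  rw [hunion]
  exact Set.ncard_iUnion_le_of_fintype _

theorem uniformProb_not [Finite α] (h𝒮 : 𝒮.Nonempty) (P : α → Prop) :
    uniformProb 𝒮 (fun ω => ¬ P ω) = 1 - uniformProb 𝒮 P := by
  have hcard : ({ω ∈ 𝒮 | P ω}.ncard : ℚ) + {ω ∈ 𝒮 | ¬ P ω}.ncard = 𝒮.ncard := by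
    rw [← Nat.cast_add, ← Set.ncard_union_eq (Set.disjoint_left.2 fun ω h h' => h'.2 h.2),
      ← Set.sep_or]
    simp only [em, Set.sep_true]
  have hpos : (𝒮.ncard : ℚ) ≠ 0 :=
    Nat.cast_ne_zero.2 (Set.ncard_ne_zero_of_mem h𝒮.some_mem)
  rw [uniformProb, uniformProb, eq_sub_iff_add_eq, ← add_div, add_comm, hcard, div_self hpos]

theorem uniformProb_lt_of_ncard_lt [Finite α]
    (h : {ω ∈ 𝒮 | P ω}.ncard < {ω ∈ 𝒮 | Q ω}.ncard) : uniformProb 𝒮 P < uniformProb 𝒮 Q := by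
  have hpos : 0 < 𝒮.ncard :=
    (Nat.zero_le _).trans_lt (h.trans_le (Set.ncard_le_ncard (Set.sep_subset _ _)))
  exact div_lt_div_of_pos_right (mod_cast h) (mod_cast hpos)

theorem uniformProb_add_div_le [Finite α] {m N : ℕ}
    (h : {ω ∈ 𝒮 | P ω}.ncard + m ≤ {ω ∈ 𝒮 | Q ω}.ncard) (hN : 𝒮.ncard ≤ N) :
    uniformProb 𝒮 P + m / N ≤ uniformProb 𝒮 Q := by
  have hle : {ω ∈ 𝒮 | Q ω}.ncard ≤ 𝒮.ncard := Set.ncard_le_ncard (Set.sep_subset _ _)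
  rcases Nat.eq_zero_or_pos 𝒮.ncard with h0 | hpos
  · obtain rfl : m = 0 := by omega
    simp [uniformProb, h0]
  · have hm : (m : ℚ) / N ≤ m / 𝒮.ncard := by gcongr
    refine (add_le_add_right hm _).trans ?_
    rw [uniformProb, uniformProb, ← add_div]
    gcongr
    exact_mod_cast h

end UniformProb

section RandomSet

variable {E : Type*}

/-- Whether the event `P` holds for a random set depends only on the elements of `U` in it. -/
def DeterminedOn (P : Set E → Prop) (U : Set E) : Prop :=
  ∀ ⦃X Y⦄, X ∩ U = Y ∩ U → (P X ↔ P Y)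

theorem DeterminedOn.mono {P : Set E → Prop} {U V : Set E} (h : DeterminedOn P U) (hUV : U ⊆ V) :
    DeterminedOn P V := by
  intro X Y hXY
  apply h
  rw [← Set.inter_eq_right.2 hUV, ← Set.inter_assoc, hXY, Set.inter_assoc]

theorem DeterminedOn.not {P : Set E → Prop} {U : Set E} (h : DeterminedOn P U) :
    DeterminedOn (fun X => ¬ P X) U :=
  fun _ _ hXY => not_congr (h hXY)

theorem determinedOn_subset (B : Set E) : DeterminedOn (fun X => B ⊆ X) B := by
  intro X Y hXY
  beta_reduce
  rw [← Set.inter_eq_right, hXY, Set.inter_eq_right]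

theorem determinedOn_forall {ι : Sort*} {P : ι → Set E → Prop} {U : Set E}
    (h : ∀ i, DeterminedOn (P i) U) : DeterminedOn (fun X => ∀ i, P i X) U :=
  fun _ _ hXY => forall_congr' fun i => h i hXY

theorem determinedOn_exists {ι : Sort*} {P : ι → Set E → Prop} {U : Set E}
    (h : ∀ i, DeterminedOn (P i) U) : DeterminedOn (fun X => ∃ i, P i X) U :=
  fun _ _ hXY => exists_congr fun i => h i hXY

theorem determinedOn_preimage {I : Type*} (ι : I → E) (R : Set I → Prop) :
    DeterminedOn (fun X => R (ι ⁻¹' X)) (Set.range ι) := by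
  intro X Y hXY
  beta_reduce
  rw [← Set.preimage_inter_range, hXY, Set.preimage_inter_range]

/-- The superset of `A` whose elements outside `A` are those `e` with `ι e ∈ X`. -/
def trace {E' : Type*} {A : Set E'} (ι : ↥Aᶜ → E) (X : Set E) : Set E' :=
  A ∪ Subtype.val '' (ι ⁻¹' X)

theorem subset_trace {E' : Type*} {A : Set E'} (ι : ↥Aᶜ → E) (X : Set E) : A ⊆ trace ι X :=
  Set.subset_union_left

theorem mem_trace {E' : Type*} {A : Set E'} {ι : ↥Aᶜ → E} {X : Set E} {e : E'} :
    e ∈ trace ι X ↔ ∀ h : e ∉ A, ι ⟨e, h⟩ ∈ X := by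
  by_cases he : e ∈ A <;> simp [trace, he]

theorem determinedOn_trace {E' : Type*} {A : Set E'} (ι : ↥Aᶜ → E) (R : Set E' → Prop) :
    DeterminedOn (fun X => R (trace ι X)) (Set.range ι) :=
  determinedOn_preimage ι fun Z => R (A ∪ Subtype.val '' Z)

/-- The probability of the event `P` for a uniformly random subset of `E`. -/
noncomputable abbrev randomSetProb (P : Set E → Prop) : ℚ := uniformProb Set.univ P

/-- The set that agrees with `X` on `U` and with `Y` elsewhere. -/
def splice (U X Y : Set E) : Set E := X ∩ U ∪ Y \ U

theorem splice_inter (U X Y : Set E) : splice U X Y ∩ U = X ∩ U := by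
  unfold splice; grind

theorem splice_inter_compl (U X Y : Set E) : splice U X Y ∩ Uᶜ = Y ∩ Uᶜ := by
  unfold splice; grind

theorem splice_splice (U X Y : Set E) : splice U (splice U X Y) (splice U Y X) = X := by
  unfold splice; grind

variable [Finite E]

theorem randomSetProb_and {P Q : Set E → Prop} {U : Set E} (hP : DeterminedOn P U)
    (hQ : DeterminedOn Q Uᶜ) :
    randomSetProb (fun X => P X ∧ Q X) = randomSetProb P * randomSetProb Q := by
  -- Exchanging the parts of two independent random sets inside `U` preserves their distribution.
  have hswap : Set.BijOn (fun Z : Set E × Set E => (splice U Z.1 Z.2, splice U Z.2 Z.1))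
      ({X | P X ∧ Q X} ×ˢ Set.univ) ({X | P X} ×ˢ {X | Q X}) := by
    refine ⟨fun Z hZ => ⟨(hP (splice_inter _ _ _)).2 hZ.1.1,
      (hQ (splice_inter_compl _ _ _)).2 hZ.1.2⟩, fun Z _ Z' _ h => ?_, fun Z hZ => ?_⟩
    · obtain ⟨h₁, h₂⟩ := Prod.mk.inj h
      refine Prod.ext ?_ ?_
      · rw [← splice_splice U Z.1 Z.2, h₁, h₂, splice_splice]
      · rw [← splice_splice U Z.2 Z.1, h₁, h₂, splice_splice]
    · exact ⟨(splice U Z.1 Z.2, splice U Z.2 Z.1),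
        ⟨⟨(hP (splice_inter _ _ _)).2 hZ.1, (hQ (splice_inter_compl _ _ _)).2 hZ.2⟩, trivial⟩,
        Prod.ext (splice_splice _ _ _) (splice_splice _ _ _)⟩
  have hcard : ({X | P X ∧ Q X}.ncard : ℚ) * (Set.univ : Set (Set E)).ncard =
      {X | P X}.ncard * {X | Q X}.ncard := by
    exact_mod_cast (Set.ncard_prod.symm.trans hswap.ncard_eq).trans Set.ncard_prod
  have hpos : ((Set.univ : Set (Set E)).ncard : ℚ) ≠ 0 :=
    Nat.cast_ne_zero.2 (Set.ncard_ne_zero_of_mem (Set.mem_univ ∅))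
  simp only [randomSetProb, uniformProb, Set.mem_univ, true_and]
  field_simp
  exact hcard

theorem randomSetProb_mem (e : E) : randomSetProb (fun X => e ∈ X) = 1 / 2 := by
  have hcompl : randomSetProb (fun X => e ∈ X) = randomSetProb (fun X => e ∉ X) :=
    uniformProb_eq_of_bijOn (Set.bijOn_univ.2 compl_bijective) fun X _ => by simp
  rw [randomSetProb, randomSetProb, uniformProb_not Set.univ_nonempty] at hcompl
  linarith

theorem randomSetProb_subset (B : Set E) :
    randomSetProb (fun X => B ⊆ X) = (1 / 2) ^ B.ncard := by
  induction B, B.toFinite using Set.Finite.induction_on with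
  | empty => simp [randomSetProb, uniformProb]
  | @insert e B he _ ih =>
    have hsplit : randomSetProb (fun X => insert e B ⊆ X) =
        randomSetProb (fun X => {e} ⊆ X ∧ B ⊆ X) := by
      simp only [Set.insert_subset_iff, Set.singleton_subset_iff]
    rw [hsplit, randomSetProb_and (determinedOn_subset {e}) ((determinedOn_subset B).mono
      (Set.subset_compl_singleton_iff.2 he)), ih, Set.ncard_insert_of_notMem he, pow_succ']
    simp only [Set.singleton_subset_iff, randomSetProb_mem]

theorem randomSetProb_forall_not_subset {J : Type*} [Fintype J] {blk : J → Set E}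
    (hblk : Pairwise fun i j => Disjoint (blk i) (blk j)) :
    randomSetProb (fun X => ∀ j, ¬ blk j ⊆ X) = ∏ j, (1 - (1 / 2) ^ (blk j).ncard) := by
  suffices h : ∀ s : Finset J, randomSetProb (fun X => ∀ j ∈ s, ¬ blk j ⊆ X) =
      ∏ j ∈ s, (1 - (1 / 2) ^ (blk j).ncard) by
    simpa using h Finset.univ
  classical
  intro s
  induction s using Finset.induction_on with
  | empty => simp [randomSetProb, uniformProb]
  | insert i s hi ih =>
    have hothers : DeterminedOn (fun X => ∀ j ∈ s, ¬ blk j ⊆ X) (blk i)ᶜ :=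
      determinedOn_forall fun j => determinedOn_forall fun hj =>
        ((determinedOn_subset _).mono (Set.subset_compl_iff_disjoint_left.2
          (hblk (ne_of_mem_of_not_mem hj hi).symm))).not
    simp only [Finset.forall_mem_insert]
    rw [randomSetProb_and (determinedOn_subset _).not hothers, ih, Finset.prod_insert hi,
      randomSetProb, uniformProb_not Set.univ_nonempty, ← randomSetProb, randomSetProb_subset]

theorem randomSetProb_preimage {I : Type*} {ι : I → E} (hι : ι.Injective) (R : Set I → Prop) :
    randomSetProb (fun X => R (ι ⁻¹' X)) = randomSetProb R := by
  have hsplit : ∀ R : Set I → Prop, {X : Set E | R (ι ⁻¹' X)}.ncard =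
      {Y | R Y}.ncard * (Set.univ : Set (Set ↥(Set.range ι)ᶜ)).ncard := by
    intro R
    rw [← Set.ncard_prod]
    refine Set.BijOn.ncard_eq (f := fun X => (ι ⁻¹' X, Subtype.val ⁻¹' X))
      ⟨fun X hX => ⟨hX, trivial⟩, fun X _ X' _ h => ?_, fun Z hZ => ?_⟩
    · obtain ⟨h₁, h₂⟩ := Prod.mk.inj h
      ext e
      by_cases he : e ∈ Set.range ι
      · obtain ⟨i, rfl⟩ := he
        exact Set.ext_iff.1 h₁ i
      · exact Set.ext_iff.1 h₂ ⟨e, he⟩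
    · have hι' : ι ⁻¹' (ι '' Z.1 ∪ Subtype.val '' Z.2) = Z.1 := by
        ext i; simp [hι.eq_iff]
      have hval : (Subtype.val ⁻¹' (ι '' Z.1 ∪ Subtype.val '' Z.2) : Set ↥(Set.range ι)ᶜ) =
          Z.2 := by
        ext ⟨e, he⟩; grind
      refine ⟨ι '' Z.1 ∪ Subtype.val '' Z.2, ?_, Prod.ext hι' hval⟩
      rw [Set.mem_ofPred_eq, hι']
      exact hZ.1
  have hpos : ((Set.univ : Set (Set ↥(Set.range ι)ᶜ)).ncard : ℚ) ≠ 0 :=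
    Nat.cast_ne_zero.2 (Set.ncard_ne_zero_of_mem (Set.mem_univ ∅))
  have huniv := hsplit fun _ => True
  simp only [Set.ofPred_true] at huniv
  simp only [randomSetProb, uniformProb, Set.mem_univ, true_and, hsplit, huniv, Nat.cast_mul]
  exact mul_div_mul_right _ _ hpos

theorem randomSetProb_trace {E' : Type*} {A : Set E'} {ι : ↥Aᶜ → E} (hι : ι.Injective)
    (R : Set E' → Prop) : randomSetProb (fun X => R (trace ι X)) = uniformProb {Y | A ⊆ Y} R := by
  have hbij : Set.BijOn (fun Z : Set ↥Aᶜ => A ∪ Subtype.val '' Z) Set.univ {Y | A ⊆ Y} := by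
    refine ⟨fun Z _ => Set.subset_union_left, fun Z _ Z' _ h => ?_, fun Y hY =>
      ⟨Subtype.val ⁻¹' Y, trivial, ?_⟩⟩
    · ext e
      have he : e.1 ∉ A := e.2
      simpa [he] using Set.ext_iff.1 h e
    · beta_reduce
      rw [Subtype.image_preimage_coe, Set.union_inter_distrib_left, Set.union_compl_self,
        Set.univ_inter, Set.union_eq_right.2 hY]
  exact (randomSetProb_preimage hι _).trans (uniformProb_eq_of_bijOn hbij fun _ _ => Iff.rfl)

theorem randomSetProb_lt_of_determinedOn {P₀ P₁ Q₀ Q₁ G : Set E → Prop} {U : Set E}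
    (hQ₀ : DeterminedOn Q₀ U) (hQ₁ : DeterminedOn Q₁ U) (hG : DeterminedOn G Uᶜ)
    (h₀ : ∀ X, G X → P₀ X → Q₀ X) (h₁ : ∀ X, G X → Q₁ X → P₁ X) {d : ℚ}
    (hd : randomSetProb Q₀ + d ≤ randomSetProb Q₁)
    (hbad : randomSetProb (fun X => ¬ G X) * (1 + d) < d) :
    randomSetProb P₀ < randomSetProb P₁ := by
  have hcompl : randomSetProb (fun X => ¬ G X) = 1 - randomSetProb G :=
    uniformProb_not Set.univ_nonempty G
  have hgood : 0 ≤ randomSetProb G := by unfold randomSetProb uniformProb; positivity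
  calc randomSetProb P₀
      ≤ randomSetProb (fun X => (Q₀ X ∧ G X) ∨ ¬ G X) :=
        uniformProb_mono fun X _ hP => by
          by_cases hX : G X
          exacts [.inl ⟨h₀ X hX hP, hX⟩, .inr hX]
    _ ≤ randomSetProb Q₀ * randomSetProb G + randomSetProb (fun X => ¬ G X) := by
        rw [← randomSetProb_and hQ₀ hG]
        exact uniformProb_or_le
    _ < randomSetProb Q₁ * randomSetProb G := by
        have := mul_le_mul_of_nonneg_right hd hgood
        rw [hcompl] at hbad ⊢
        linarith
    _ = randomSetProb (fun X => Q₁ X ∧ G X) := (randomSetProb_and hQ₁ hG).symm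
    _ ≤ randomSetProb P₁ := uniformProb_mono fun X _ hX => h₁ X hX.2 hX.1

/-- Some block of each of the families of blocks is contained in `X`. -/
def ContainsBlocks {B J : Type*} (blk : B → J → Set E) (X : Set E) : Prop :=
  ∀ b, ∃ j, blk b j ⊆ X

theorem randomSetProb_lt_of_blocks {E' B J : Type*} [Fintype B] [Fintype J] {A : Set E'}
    {ι : ↥Aᶜ → E} (hι : ι.Injective) {blk : B → J → Set E}
    (hblk : ∀ b, Pairwise fun i j => Disjoint (blk b i) (blk b j))
    (hdisj : ∀ b j, Disjoint (Set.range ι) (blk b j)) {P₀ P₁ : Set E → Prop}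
    {R₀ R₁ : Set E' → Prop} (h₀ : ∀ X, ContainsBlocks blk X → (P₀ X ↔ R₀ (trace ι X)))
    (h₁ : ∀ X, ContainsBlocks blk X → (P₁ X ↔ R₁ (trace ι X))) {d : ℚ} (hd₀ : 0 ≤ d)
    (hd : uniformProb {Y | A ⊆ Y} R₀ + d ≤ uniformProb {Y | A ⊆ Y} R₁)
    (hbad : (∑ b, ∏ j, (1 - (1 / 2) ^ (blk b j).ncard)) * (1 + d) < d) :
    randomSetProb P₀ < randomSetProb P₁ := by
  have hG : DeterminedOn (ContainsBlocks blk) (Set.range ι)ᶜ :=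
    determinedOn_forall fun b => determinedOn_exists fun j => (determinedOn_subset _).mono
      (Set.subset_compl_iff_disjoint_left.2 (hdisj b j))
  rw [← randomSetProb_trace hι, ← randomSetProb_trace hι] at hd
  refine randomSetProb_lt_of_determinedOn (determinedOn_trace ι R₀) (determinedOn_trace ι R₁) hG
    (fun X hX => (h₀ X hX).1) (fun X hX => (h₁ X hX).2) hd (lt_of_le_of_lt ?_ hbad)
  gcongr
  calc randomSetProb (fun X => ¬ ContainsBlocks blk X)
      = randomSetProb (fun X => ∃ b, ∀ j, ¬ blk b j ⊆ X) := by
        simp only [ContainsBlocks, not_forall, not_exists]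
    _ ≤ ∑ b, randomSetProb (fun X => ∀ j, ¬ blk b j ⊆ X) := uniformProb_exists_le _
    _ = ∑ b, ∏ j, (1 - (1 / 2) ^ (blk b j).ncard) :=
        Finset.sum_congr rfl fun b _ => randomSetProb_forall_not_subset (hblk b)

end RandomSet

/-! ### Steps in bunkbed structures -/

theorem reflTransGen_iff_of_retraction {α β : Type*} {r : α → α → Prop} {s : β → β → Prop}
    {f : β → α} {g : α → β} (hgf : Function.LeftInverse g f)
    (hf : ∀ a b, s a b → Relation.ReflTransGen r (f a) (f b))
    (hg : ∀ a b, r a b → Relation.ReflTransGen s (g a) (g b)) {a b : β} :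
    Relation.ReflTransGen r (f a) (f b) ↔ Relation.ReflTransGen s a b := by
  refine ⟨fun h => ?_, fun h => Relation.ReflTransGen.lift' f hf _ _ h⟩
  simpa only [Function.onFun, hgf a, hgf b] using Relation.ReflTransGen.lift' g hg _ _ h

theorem reflTransGen_preserves {α : Type*} {r : α → α → Prop} {P : α → Prop}
    (hr : ∀ a b, r a b → P a → P b) {a b : α} (h : Relation.ReflTransGen r a b) (ha : P a) : P b :=
  h.rec ha fun _ hbc hb => hr _ _ hbc hb

section

variable {V : Type} {Q : Net V} {x y z : V} {l m : Fin 2}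

/-- One can step from `x` to `y` along an edge in `X`; `Conn N X` is the reflexive transitive
closure of this relation. -/
def Step (N : Net V) (X : Set N.Edge) (x y : V) : Prop := ∃ e ∈ X, N.Joins e x y

theorem step_bunkbed {X : Set (BEdge Q)} : Step (bunkbed Q) X (x, l) (y, m) ↔
    (l = m ∧ ∃ e, Sum.inl (e, l) ∈ X ∧ Q.Joins e x y) ∨ (x = y ∧ l ≠ m ∧ Sum.inr x ∈ X) := by
  constructor
  · rintro ⟨⟨e, i⟩ | v, he, h⟩
    · obtain ⟨rfl, rfl, h⟩ := h
      exact .inl ⟨rfl, e, he, h⟩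
    · obtain ⟨rfl, rfl, h⟩ := h
      exact .inr ⟨rfl, h, he⟩
  · rintro (⟨rfl, e, he, h⟩ | ⟨rfl, h, he⟩)
    exacts [⟨.inl (e, l), he, rfl, rfl, h⟩, ⟨.inr x, he, rfl, rfl, h⟩]

theorem step_bunkbed_of_joins {X : Set (BEdge Q)} {e : Q.Edge} (he : Sum.inl (e, l) ∈ X)
    (h : Q.Joins e x y) : Step (bunkbed Q) X (x, l) (y, l) :=
  step_bunkbed.2 (.inl ⟨rfl, e, he, h⟩)

theorem conn_bunkbed_of_vertical {X : Set (BEdge Q)} (h : Sum.inr x ∈ X) (l m : Fin 2) :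
    Conn (bunkbed Q) X (x, l) (x, m) := by
  by_cases hlm : l = m
  · rw [hlm]
    exact .refl
  · exact .single (step_bunkbed.2 (.inr ⟨rfl, hlm, h⟩))

/-- The edges retained in site percolation with the set `W` of open vertices. -/
def openEdges (G : SimpleGraph V) (W : Set (V × Fin 2)) : Set (BEdge (ofGraph G)) :=
  {e | ends (bunkbed (ofGraph G)) e ⊆ W}

theorem step_openEdges {G : SimpleGraph V} {W : Set (V × Fin 2)} :
    Step (bunkbed (ofGraph G)) (openEdges G W) (x, l) (y, m) ↔
      ((x, l) ∈ W ∧ (y, m) ∈ W) ∧ ((l = m ∧ G.Adj x y) ∨ (x = y ∧ l ≠ m)) := by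
  rw [step_bunkbed]
  constructor
  · rintro (⟨rfl, e, he, h⟩ | ⟨rfl, hlm, he⟩)
    · have hadj : G.Adj x y := by simpa [← G.mem_edgeSet, ← show e.1 = s(x, y) from h] using e.2
      refine ⟨⟨he ⟨(y, l), .inl ⟨rfl, rfl, h⟩⟩, he ⟨(x, l), .inr ⟨rfl, rfl, h⟩⟩⟩, .inl ⟨rfl, hadj⟩⟩
    · exact ⟨⟨he ⟨(x, m), .inl ⟨rfl, rfl, hlm⟩⟩, he ⟨(x, l), .inr ⟨rfl, rfl, hlm⟩⟩⟩,
        .inr ⟨rfl, hlm⟩⟩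
  · rintro ⟨⟨hx, hy⟩, ⟨rfl, hadj⟩ | ⟨rfl, hlm⟩⟩
    · refine .inl ⟨rfl, ⟨s(x, y), hadj⟩, ?_, rfl⟩
      rintro ⟨v, i⟩ ⟨⟨w, j⟩, ⟨rfl, rfl, h⟩ | ⟨rfl, rfl, h⟩⟩
      all_goals
        obtain ⟨rfl, rfl⟩ | ⟨rfl, rfl⟩ := Sym2.eq_iff.1 (show s(x, y) = _ from h) <;> assumption
    · refine .inr ⟨rfl, hlm, ?_⟩
      rintro ⟨v, i⟩ ⟨⟨w, j⟩, ⟨rfl, rfl, _⟩ | ⟨rfl, rfl, _⟩⟩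
      all_goals
        obtain rfl | rfl : i = l ∨ i = m := by grind
        all_goals assumption

theorem not_bunkbedConjecture {M : Model (bunkbed Q)} {u v : V}
    (h : M.prob (u, 0) (v, 0) < M.prob (u, 0) (v, 1)) : ¬ BunkbedConjecture M :=
  fun hM => (hM u v).not_gt h

end

/-! ### Chains of three-element cells -/

/-- The vertices of a chain of six cells: the seven vertices of a path, and three posts, at which
one can always change the layer. -/
abbrev ChainVertex : Type := Fin 7 ⊕ Fin 3

/-- The post contained in each cell. -/
def cellPost : Fin 6 → Fin 3 := ![0, 1, 2, 0, 2, 1]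

/-- Each cell consists of two consecutive vertices of the path and of a post. -/
def ChainMem (j : Fin 6) (v : ChainVertex) : Prop :=
  v = .inl j.castSucc ∨ v = .inl j.succ ∨ v = .inr (cellPost j)

instance (j : Fin 6) (v : ChainVertex) : Decidable (ChainMem j v) := by
  unfold ChainMem; infer_instance

theorem chainMem_inr {j : Fin 6} {t : Fin 3} : ChainMem j (.inr t) ↔ t = cellPost j := by
  simp [ChainMem]

/-- A percolation configuration on the bunkbed of the chain: a cell is traversed through one of its
retained middle edges, one per layer, and one may change the layer before or after the middle edge
if the entry or the exit of the cell has a vertical edge. -/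
@[ext] structure ChainState where
  middle : Fin 6 → Fin 2 → Prop
  entry : Fin 6 → Prop
  exit : Fin 6 → Prop
  vert : Fin 7 → Prop

namespace ChainState

theorem injective_toProd :
    Function.Injective fun s : ChainState => (s.middle, s.entry, s.exit, s.vert) :=
  fun s t h => by simpa [ChainState.ext_iff] using h

instance : Finite ChainState := .of_injective _ injective_toProd

/-- The cell `j` can be traversed from layer `l` to layer `m`. -/
def Passes (s : ChainState) (j : Fin 6) (l m : Fin 2) : Prop :=
  ∃ k, (l = k ∨ s.entry j) ∧ s.middle j k ∧ (k = m ∨ s.exit j)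

/-- The middle edge of the cell `j` is retained in both layers or in none. -/
def Balanced (s : ChainState) (j : Fin 6) : Prop := s.middle j 0 ↔ s.middle j 1

/-- There is a vertical edge at the vertex `v`. -/
def VertAt (s : ChainState) : ChainVertex → Prop
  | .inl q => s.vert q
  | .inr _ => True

/-- A step through a cell or along a vertical edge. -/
def Step (s : ChainState) (p q : ChainVertex × Fin 2) : Prop :=
  (∃ j, ChainMem j p.1 ∧ ChainMem j q.1 ∧ s.Passes j p.2 q.2) ∨ (p.1 = q.1 ∧ s.VertAt p.1)

/-- Reachability by a sequence of steps. -/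
def Reach (s : ChainState) : ChainVertex × Fin 2 → ChainVertex × Fin 2 → Prop :=
  Relation.ReflTransGen s.Step

/-- The last vertex of the path in layer `i` can be reached from the first in layer `0`. -/
def Hits (s : ChainState) (i : Fin 2) : Prop := s.Reach (.inl 0, 0) (.inl 6, i)

/-- One can enter and leave the cells only in the layer of the middle edge that is used. -/
def PreservesLayers (s : ChainState) : Prop := ∀ j, ¬ s.entry j ∧ ¬ s.exit j

/-- At some place one may exchange the layers of everything behind it. -/
def Cut (s : ChainState) : Prop := (∃ q, s.vert q) ∨ ∃ j, s.Balanced j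

/-- Exchange the layers in the cells `j` with `f j = 1`. -/
def flip (f : Fin 6 → Fin 2) (s : ChainState) : ChainState :=
  { s with middle := fun j l => s.middle j (l + f j) }

variable {s : ChainState} {f : Fin 6 → Fin 2} {g : ChainVertex → Fin 2}

theorem PreservesLayers.passes_iff (hs : s.PreservesLayers) {j : Fin 6} {l m : Fin 2} :
    s.Passes j l m ↔ l = m ∧ s.middle j l := by
  simp only [Passes, (hs j).1, (hs j).2, or_false]
  grind

theorem not_cut_iff :
    ¬ s.Cut ↔ (∀ q, ¬ s.vert q) ∧ ∀ j, Xor (s.middle j 0) (s.middle j 1) := by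
  simp only [Cut, Balanced, not_or, not_exists, xor_iff_not_iff]

theorem fin_two_add_add (l b : Fin 2) : l + b + b = l := by revert l b; decide

theorem flip_flip (f : Fin 6 → Fin 2) (s : ChainState) : (s.flip f).flip f = s := by
  simp [flip, fin_two_add_add]

theorem balanced_flip {j : Fin 6} : (s.flip f).Balanced j ↔ s.Balanced j := by
  rcases Fin.exists_fin_two.1 ⟨f j, rfl⟩ with h | h <;>
    simp [Balanced, flip, h, iff_comm]

theorem vertAt_flip {v : ChainVertex} : (s.flip f).VertAt v ↔ s.VertAt v := by
  cases v <;> rfl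

theorem cut_flip : (s.flip f).Cut ↔ s.Cut := by
  simp only [Cut, balanced_flip]; rfl

theorem Balanced.middle_iff {j : Fin 6} (h : s.Balanced j) (k l : Fin 2) :
    s.middle j k ↔ s.middle j l := by
  revert k l
  rw [Balanced] at h
  simp [Fin.forall_fin_two, h]

theorem Passes.add {j : Fin 6} {l m : Fin 2} (h : s.Passes j l m) {t : ChainState} {b : Fin 2}
    (hentry : t.entry j = s.entry j) (hexit : t.exit j = s.exit j)
    (hmiddle : ∀ k, s.middle j k → t.middle j (k + b)) : t.Passes j (l + b) (m + b) := by
  obtain ⟨k, hin, hk, hout⟩ := h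
  exact ⟨k + b, by simpa [hentry] using hin, hmiddle k hk, by simpa [hexit] using hout⟩

/-- Flipping the cells according to `f` turns paths into paths when their vertices are moved to the
other layer according to `g`, and the target of `Hits` is moved. -/
def IsExchange (s : ChainState) (f : Fin 6 → Fin 2) (g : ChainVertex → Fin 2) : Prop :=
  g (.inl 0) = 0 ∧ g (.inl 6) = 1 ∧
    ∀ j v, ChainMem j v → s.VertAt v ∨ g v = f j ∨ s.Balanced j

theorem isExchange_flip {f' : Fin 6 → Fin 2} : (s.flip f').IsExchange f g ↔ s.IsExchange f g := by
  simp only [IsExchange, vertAt_flip, balanced_flip]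

theorem exists_isExchange_of_vert {q : Fin 7} (hq : s.vert q) : ∃ f g, s.IsExchange f g := by
  refine ⟨fun j => if q ≤ j.castSucc then 1 else 0,
    Sum.elim (fun p => if q ≤ p ∧ p ≠ 0 then 1 else 0) 0, by simp, ?_, ?_⟩
  · simpa using Fin.le_last q
  · rintro j v (rfl | rfl | rfl)
    · by_cases hj : q = j.castSucc
      · exact .inl (hj ▸ hq)
      · exact .inr (.inl (by clear hq; revert hj q j; decide))
    · by_cases hj : q = j.succ
      · exact .inl (hj ▸ hq)
      · exact .inr (.inl (by clear hq; revert hj q j; decide))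
    · exact .inl trivial

theorem exists_isExchange_of_balanced {c : Fin 6} (hc : s.Balanced c) :
    ∃ f g, s.IsExchange f g := by
  refine ⟨fun j => if c < j then 1 else 0,
    Sum.elim (fun p => if c.castSucc < p then 1 else 0) 0, by simp, ?_, ?_⟩
  · simpa using Fin.castSucc_lt_last c
  · rintro j v (rfl | rfl | rfl)
    · exact .inr (.inl (by simp))
    · by_cases hj : j = c
      · exact .inr (.inr (hj ▸ hc))
      · exact .inr (.inl (by clear hc; revert hj c j; decide))
    · exact .inl trivial

theorem Cut.exists_isExchange (h : s.Cut) : ∃ f g, s.IsExchange f g := by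
  rcases h with ⟨q, hq⟩ | ⟨j, hj⟩
  exacts [exists_isExchange_of_vert hq, exists_isExchange_of_balanced hj]

theorem step_of_vertAt {v : ChainVertex} (hv : s.VertAt v) (l m : Fin 2) : s.Step (v, l) (v, m) :=
  .inr ⟨rfl, hv⟩

theorem step_post (s : ChainState) (t : Fin 3) (l m : Fin 2) : s.Step (.inr t, l) (.inr t, m) :=
  .inr ⟨rfl, trivial⟩

theorem IsExchange.reach_of_not_balanced (h : s.IsExchange f g) {j : Fin 6} {v : ChainVertex}
    (hv : ChainMem j v) (hj : ¬ s.Balanced j) (l : Fin 2) :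
    (s.flip f).Reach (v, l + g v) (v, l + f j) ∧ (s.flip f).Reach (v, l + f j) (v, l + g v) := by
  rcases h.2.2 j v hv with hvert | heq | hbal
  · exact ⟨.single (step_of_vertAt (vertAt_flip.2 hvert) _ _),
      .single (step_of_vertAt (vertAt_flip.2 hvert) _ _)⟩
  · rw [heq]
    exact ⟨.refl, .refl⟩
  · exact absurd hbal hj

theorem IsExchange.reach_flip_of_step (h : s.IsExchange f g) {p q : ChainVertex × Fin 2}
    (hpq : s.Step p q) : (s.flip f).Reach (p.1, p.2 + g p.1) (q.1, q.2 + g q.1) := by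
  obtain ⟨x, l⟩ := p
  obtain ⟨y, m⟩ := q
  rcases hpq with ⟨j, hx, hy, hp⟩ | ⟨rfl : x = y, hv⟩
  · by_cases hj : s.Balanced j
    · -- A balanced cell can be traversed in both layers: change the layer at its post.
      have hpass : ∀ b, (s.flip f).Passes j (l + b) (m + b) := fun b =>
        hp.add rfl rfl fun k hk => (hj.middle_iff _ _).1 hk
      have hpost : ChainMem j (.inr (cellPost j)) := chainMem_inr.2 rfl
      exact .head (.inl ⟨j, hx, hpost, hpass (g x)⟩) (.head (step_post _ _ _ (l + g y))
        (.single (.inl ⟨j, hpost, hy, hpass (g y)⟩)))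
    · have hpass : (s.flip f).Passes j (l + f j) (m + f j) :=
        hp.add rfl rfl fun k hk => by simpa [flip, fin_two_add_add] using hk
      have hstep : (s.flip f).Step (x, l + f j) (y, m + f j) := .inl ⟨j, hx, hy, hpass⟩
      exact ((h.reach_of_not_balanced hx hj l).1.tail hstep).trans
        (h.reach_of_not_balanced hy hj m).2
  · exact .single (step_of_vertAt (vertAt_flip.2 hv) _ _)

theorem IsExchange.hits_flip (h : s.IsExchange f g) (hs : s.Hits 0) : (s.flip f).Hits 1 := by
  have := Relation.ReflTransGen.lift' (fun p : ChainVertex × Fin 2 => (p.1, p.2 + g p.1))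
    (fun _ _ => h.reach_flip_of_step) _ _ hs
  simpa [Function.onFun, h.1, h.2.1, Hits, Reach] using this

/-- The cells to be flipped in some exchange; it depends only on data which do not change under
flips. -/
noncomputable def exchange (s : ChainState) : Fin 6 → Fin 2 :=
  Classical.epsilon fun f => ∃ g, s.IsExchange f g

theorem exchange_flip : (s.flip f).exchange = s.exchange := by
  simp only [exchange, isExchange_flip]

theorem Cut.hits_flip_exchange (h : s.Cut) (hs : s.Hits 0) : (s.flip s.exchange).Hits 1 := by
  obtain ⟨g, hg⟩ := Classical.epsilon_spec h.exists_isExchange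
  exact hg.hits_flip hs

theorem injective_flip_exchange : Function.Injective fun s : ChainState => s.flip s.exchange := by
  refine Function.LeftInverse.injective (g := fun s => s.flip s.exchange) fun s => ?_
  simp only [exchange_flip, flip_flip]

theorem ncard_hits_le_of_not_cut {𝒮 : Set ChainState} (h𝒮 : ∀ f, ∀ s ∈ 𝒮, s.flip f ∈ 𝒮) {m : ℕ}
    (h : {s ∈ 𝒮 | ¬ s.Cut ∧ s.Hits 0}.ncard + m ≤ {s ∈ 𝒮 | ¬ s.Cut ∧ s.Hits 1}.ncard) :
    {s ∈ 𝒮 | s.Hits 0}.ncard + m ≤ {s ∈ 𝒮 | s.Hits 1}.ncard := by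
  have hcut : {s ∈ 𝒮 | s.Cut ∧ s.Hits 0}.ncard ≤ {s ∈ 𝒮 | s.Cut ∧ s.Hits 1}.ncard :=
    Set.ncard_le_ncard_of_injOn _
      (fun s hs => ⟨h𝒮 _ s hs.1, cut_flip.2 hs.2.1, hs.2.1.hits_flip_exchange hs.2.2⟩)
      injective_flip_exchange.injOn
  have hsplit : ∀ i, {s ∈ 𝒮 | s.Hits i}.ncard =
      {s ∈ 𝒮 | s.Cut ∧ s.Hits i}.ncard + {s ∈ 𝒮 | ¬ s.Cut ∧ s.Hits i}.ncard := by
    intro i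
    rw [← Set.ncard_union_eq (Set.disjoint_left.2 fun s hs hs' => hs'.2.1 hs.2.1), ← Set.sep_or]
    congr 1
    ext s
    simp only [Set.mem_ofPred_eq]
    tauto
  rw [hsplit, hsplit]
  omega

end ChainState

/-! ### Bit-sliced computation of connections -/

/-- A family of states of the chain without cuts, numbered by the positions of the ones of `mask`:
bit `n` of `layer j`, `entry j`, `exit j` is the layer of the middle edge of the cell `j` and tells
whether its entry and its exit have a vertical edge. -/
structure SlicedFamily where
  mask : ℕ
  layer : Fin 6 → ℕ
  entry : Fin 6 → ℕ
  exit : Fin 6 → ℕ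

namespace SlicedFamily

/-- The member of the family with number `n`. -/
def state (F : SlicedFamily) (n : ℕ) : ChainState where
  middle j l := (F.layer j).testBit n = (l == 1)
  entry j := (F.entry j).testBit n
  exit j := (F.exit j).testBit n
  vert _ := False

/-- The states in which the cell `j` can be entered (for `X = F.entry`) or left (for `X = F.exit`)
at a given vertex and layer. -/
def portBits (F : SlicedFamily) (X : Fin 6 → ℕ) (j : Fin 6) : ChainVertex → Fin 2 → ℕ
  | .inl _, l => (if l = 0 then F.mask ^^^ F.layer j else F.layer j) ||| X j
  | .inr _, _ => F.mask

/-- The states in which the cell `j` can be entered at a vertex of the set described by `ρ`. -/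
def enterBits (F : SlicedFamily) (ρ : ChainVertex → Fin 2 → ℕ) (j : Fin 6) : ℕ :=
  let atVertex v := (ρ v 0 &&& F.portBits F.entry j v 0) ||| (ρ v 1 &&& F.portBits F.entry j v 1)
  atVertex (.inl j.castSucc) ||| (atVertex (.inl j.succ) ||| atVertex (.inr (cellPost j)))

/-- Add the vertices that can be reached by passing through the cell `j`. -/
def cellStep (F : SlicedFamily) (ρ : ChainVertex → Fin 2 → ℕ) (j : Fin 6) :
    ChainVertex → Fin 2 → ℕ :=
  fun v l => if ChainMem j v then ρ v l ||| (F.enterBits ρ j &&& F.portBits F.exit j v l)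
    else ρ v l

/-- The states in which a vertex can be reached by passing through the cells of a list, starting
from its end. -/
def reachBits (F : SlicedFamily) : List (Fin 6) → ChainVertex → Fin 2 → ℕ
  | [] => fun v l => if v = .inl 0 ∧ l = 0 then F.mask else 0
  | j :: js => F.cellStep (F.reachBits js) j

/-- No further vertex can be reached by passing through a cell or along the vertical edge at a
post. -/
def IsClosed (F : SlicedFamily) (ρ : ChainVertex → Fin 2 → ℕ) : Prop :=
  (∀ t, ρ (.inr t) 0 = ρ (.inr t) 1) ∧ ∀ j v l, F.cellStep ρ j v l = ρ v l

variable {F : SlicedFamily} {n : ℕ}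

theorem exists_middle_iff (F : SlicedFamily) (n : ℕ) (j : Fin 6) :
    ∃ k, ∀ l, (F.state n).middle j l ↔ l = k := by
  cases h : (F.layer j).testBit n
  · exact ⟨0, by simp [state, h]⟩
  · exact ⟨1, by simp [state, h]⟩

theorem not_cut_state (F : SlicedFamily) (n : ℕ) : ¬ (F.state n).Cut := by
  rintro (⟨_, hq⟩ | ⟨j, hj⟩)
  · exact hq
  · obtain ⟨k, hk⟩ := F.exists_middle_iff n j
    rw [ChainState.Balanced, hk, hk] at hj
    omega

theorem testBit_portBits_inl (hn : F.mask.testBit n) (X : Fin 6 → ℕ) (j : Fin 6) (q : Fin 7)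
    (l : Fin 2) : (F.portBits X j (.inl q) l).testBit n ↔
      (F.state n).middle j l ∨ (X j).testBit n := by
  revert l
  simp [Fin.forall_fin_two, portBits, state, hn]

theorem testBit_portBits_of_middle_or (hn : F.mask.testBit n) {X : Fin 6 → ℕ} {j : Fin 6}
    {l : Fin 2} (h : (F.state n).middle j l ∨ (X j).testBit n) (v : ChainVertex) :
    (F.portBits X j v l).testBit n := by
  rcases v with q | _
  exacts [(testBit_portBits_inl hn X j q l).2 h, hn]

theorem exists_reach_of_testBit_portBits (hn : F.mask.testBit n) {X : Fin 6 → ℕ} {j : Fin 6}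
    {v : ChainVertex} {l : Fin 2} (h : (F.portBits X j v l).testBit n) :
    ∃ a, (F.state n).Reach (v, l) (v, a) ∧ (F.state n).Reach (v, a) (v, l) ∧
      ((F.state n).middle j a ∨ (X j).testBit n) := by
  rcases v with q | t
  · exact ⟨l, .refl, .refl, (testBit_portBits_inl hn X j q l).1 h⟩
  · obtain ⟨k, hk⟩ := F.exists_middle_iff n j
    exact ⟨k, .single (ChainState.step_post _ _ _ _), .single (ChainState.step_post _ _ _ _),
      .inl ((hk k).2 rfl)⟩

theorem testBit_enterBits {ρ : ChainVertex → Fin 2 → ℕ} {j : Fin 6} :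
    (F.enterBits ρ j).testBit n ↔
      ∃ v l, ChainMem j v ∧ (ρ v l).testBit n ∧ (F.portBits F.entry j v l).testBit n := by
  simp only [enterBits, Nat.testBit_or, Nat.testBit_and, Bool.or_eq_true, Bool.and_eq_true,
    Fin.exists_fin_two, ChainMem, or_and_right, exists_or, ← and_or_left, exists_eq_left]

theorem reach_of_testBit_cellStep (hn : F.mask.testBit n) {ρ : ChainVertex → Fin 2 → ℕ}
    {p : ChainVertex × Fin 2} (hρ : ∀ v l, (ρ v l).testBit n → (F.state n).Reach p (v, l))
    {j : Fin 6} {v : ChainVertex} {l : Fin 2} (h : (F.cellStep ρ j v l).testBit n) :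
    (F.state n).Reach p (v, l) := by
  rw [cellStep] at h
  split_ifs at h with hv
  · rw [Nat.testBit_or, Nat.testBit_and, Bool.or_eq_true, Bool.and_eq_true] at h
    rcases h with h | ⟨henter, hexit⟩
    · exact hρ v l h
    · obtain ⟨w, m, hw, hm, hport⟩ := testBit_enterBits.1 henter
      obtain ⟨k, hk⟩ := F.exists_middle_iff n j
      obtain ⟨a, hma, -, ha⟩ := exists_reach_of_testBit_portBits hn hport
      obtain ⟨b, -, hbl, hb⟩ := exists_reach_of_testBit_portBits hn hexit
      rw [hk] at ha hb
      have hpass : (F.state n).Passes j a b := ⟨k, ha, (hk k).2 rfl, hb.imp_left Eq.symm⟩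
      exact (((hρ w m hm).trans hma).tail (.inl ⟨j, hw, hv, hpass⟩)).trans hbl
  · exact hρ v l h

theorem testBit_cellStep_of_passes (hn : F.mask.testBit n) {ρ : ChainVertex → Fin 2 → ℕ}
    {j : Fin 6} {v w : ChainVertex} {l m : Fin 2} (hρ : (ρ w m).testBit n) (hw : ChainMem j w)
    (hv : ChainMem j v) (h : (F.state n).Passes j m l) : (F.cellStep ρ j v l).testBit n := by
  obtain ⟨k, hin, hk, hout⟩ := h
  rw [cellStep, if_pos hv, Nat.testBit_or, Nat.testBit_and, Bool.or_eq_true, Bool.and_eq_true]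
  refine .inr ⟨testBit_enterBits.2 ⟨w, m, hw, hρ, ?_⟩, ?_⟩
  · exact testBit_portBits_of_middle_or hn (hin.imp_left fun h => h ▸ hk) w
  · exact testBit_portBits_of_middle_or hn (hout.imp_left fun h => h ▸ hk) v

theorem reach_of_testBit_reachBits (hn : F.mask.testBit n) {js : List (Fin 6)} :
    ∀ v l, (F.reachBits js v l).testBit n → (F.state n).Reach (.inl 0, 0) (v, l) := by
  induction js with
  | nil =>
    intro v l h
    simp only [reachBits] at h
    split_ifs at h with hvl
    · rw [hvl.1, hvl.2]
      exact .refl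
    · simp at h
  | cons j js ih => exact fun v l => reach_of_testBit_cellStep hn ih

theorem testBit_reachBits_start (hn : F.mask.testBit n) (js : List (Fin 6)) :
    (F.reachBits js (.inl 0) 0).testBit n := by
  induction js with
  | nil => simpa [reachBits] using hn
  | cons j js ih =>
    rw [reachBits, cellStep]
    split_ifs
    · rw [Nat.testBit_or, ih, Bool.true_or]
    · exact ih

theorem IsClosed.testBit_of_reach {ρ : ChainVertex → Fin 2 → ℕ} (hρ : F.IsClosed ρ)
    (hn : F.mask.testBit n) {p q : ChainVertex × Fin 2} (hp : (ρ p.1 p.2).testBit n)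
    (h : (F.state n).Reach p q) : (ρ q.1 q.2).testBit n := by
  induction h with
  | refl => exact hp
  | @tail b c _ hbc ih =>
    rcases hbc with ⟨j, hb, hc, hpass⟩ | ⟨heq, hvert⟩
    · rw [← hρ.2 j c.1 c.2]
      exact testBit_cellStep_of_passes hn ih hb hc hpass
    · obtain ⟨_ | t, m⟩ := b
      · exact hvert.elim
      · obtain ⟨v, l⟩ := c
        obtain rfl : .inr t = v := heq
        have hpost : ∀ a, ρ (.inr t) a = ρ (.inr t) 0 := by simp [Fin.forall_fin_two, hρ.1 t]
        rwa [hpost] at ih ⊢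

theorem hits_state_iff {js : List (Fin 6)} (hjs : F.IsClosed (F.reachBits js))
    (hn : F.mask.testBit n) (i : Fin 2) :
    (F.state n).Hits i ↔ (F.reachBits js (.inl 6) i).testBit n :=
  ⟨hjs.testBit_of_reach hn (testBit_reachBits_start hn js),
    reach_of_testBit_reachBits hn (.inl 6) i⟩

/-- The states in which the layer cannot be changed at the entries and exits of a list of cells. -/
def preserveBits (F : SlicedFamily) : List (Fin 6) → ℕ
  | [] => F.mask
  | j :: js => F.preserveBits js &&& (F.mask ^^^ (F.entry j ||| F.exit j))

theorem testBit_preserveBits (hn : F.mask.testBit n) {js : List (Fin 6)} :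
    (F.preserveBits js).testBit n ↔
      ∀ j ∈ js, ¬ (F.state n).entry j ∧ ¬ (F.state n).exit j := by
  induction js with
  | nil => simpa [preserveBits] using hn
  | cons j js ih => simp [preserveBits, ih, hn, state, and_comm]

end SlicedFamily

/-! ### Counting the ones of a binary number -/

/-- The number whose ones are at the positions `w * h` with `h < q`. -/
def combBits (w : ℕ) : ℕ → ℕ
  | 0 => 0
  | q + 1 => combBits w q ||| 1 <<< (w * q)

/-- The number of ones among the lowest `w * q` bits, if `w * q < 2 ^ w - 1`. Combing out the bits
whose positions are congruent modulo `w` and reducing modulo `2 ^ w - 1` adds them up, with few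
arithmetic operations on large numbers. -/
def popCount (w q x : ℕ) : ℕ :=
  (∑ r ∈ Finset.range w, (x >>> r &&& combBits w q)) % (2 ^ w - 1)

theorem combBits_lt {w : ℕ} (hw : 0 < w) (q : ℕ) : combBits w q < 2 ^ (w * q) := by
  induction q with
  | zero => simp [combBits]
  | succ q ih =>
    rw [combBits, Nat.one_shiftLeft]
    exact Nat.or_lt_two_pow (ih.trans_le (Nat.pow_le_pow_right two_pos (by lia)))
      (Nat.pow_lt_pow_right one_lt_two (by lia))

theorem shiftRight_and_combBits_succ {w : ℕ} (hw : 0 < w) (q x r : ℕ) :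
    x >>> r &&& combBits w (q + 1) =
      (x >>> r &&& combBits w q) + 2 ^ (w * q) * (x.testBit (w * q + r)).toNat := by
  have hlt : x >>> r &&& combBits w q < 2 ^ (w * q) := Nat.and_lt_two_pow _ (combBits_lt hw q)
  rw [combBits, Nat.one_shiftLeft, Nat.and_or_distrib_left, Nat.and_two_pow, Nat.testBit_shiftRight,
    mul_comm (Bool.toNat _), add_comm (x >>> r &&& _), Nat.two_pow_add_eq_or_of_lt hlt,
    Nat.lor_comm, add_comm r]

theorem sum_shiftRight_and_combBits_modEq {w : ℕ} (hw : 0 < w) (q x : ℕ) :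
    ∑ r ∈ Finset.range w, (x >>> r &&& combBits w q) ≡
      ∑ n ∈ Finset.range (w * q), (x.testBit n).toNat [MOD 2 ^ w - 1] := by
  induction q with
  | zero => simp [combBits, Nat.ModEq.refl]
  | succ q ih =>
    have hpow : 2 ^ (w * q) ≡ 1 [MOD 2 ^ w - 1] := by
      have hone : 2 ^ w ≡ 1 [MOD 2 ^ w - 1] :=
        ((Nat.modEq_iff_dvd' Nat.one_le_two_pow).2 dvd_rfl).symm
      simpa [pow_mul] using hone.pow q
    rw [mul_add_one, Finset.sum_range_add]
    simp only [shiftRight_and_combBits_succ hw, Finset.sum_add_distrib, ← Finset.mul_sum]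
    simpa using ih.add (hpow.mul_right (∑ r ∈ Finset.range w, (x.testBit (w * q + r)).toNat))

theorem popCount_eq_ncard {w q : ℕ} (h : w * q < 2 ^ w - 1) (x : ℕ) :
    popCount w q x = {n | n < w * q ∧ x.testBit n}.ncard := by
  have hw : 0 < w := Nat.pos_of_ne_zero fun h0 => by simp [h0] at h
  have hle : ∑ n ∈ Finset.range (w * q), (x.testBit n).toNat ≤ w * q := by
    simpa using Finset.sum_le_card_nsmul (Finset.range (w * q)) (fun n => (x.testBit n).toNat) 1
      fun n _ => Bool.toNat_le _
  have hset : {n | n < w * q ∧ x.testBit n} =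
      ((Finset.range (w * q)).filter (x.testBit ·) : Set ℕ) := by simp
  rw [popCount, sum_shiftRight_and_combBits_modEq hw q x, Nat.mod_eq_of_lt (hle.trans_lt h), hset,
    Set.ncard_coe_finset, Finset.card_filter]
  exact Finset.sum_congr rfl fun n _ => by cases x.testBit n <;> rfl

/-- The number whose bit `n`, for `n < 2 ^ k`, is bit `b` of `n`. -/
def truthTable (b : ℕ) : ℕ → ℕ
  | 0 => 0
  | k + 1 => if k = b then (2 ^ 2 ^ b - 1) <<< 2 ^ b else
      truthTable b k ||| (truthTable b k <<< 2 ^ k)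

theorem truthTable_lt (b k : ℕ) : truthTable b k < 2 ^ 2 ^ k := by
  induction k with
  | zero => simp [truthTable]
  | succ k ih =>
    rw [truthTable, pow_succ 2 k, mul_two]
    split_ifs with h
    · subst h
      exact Nat.shiftLeft_lt (Nat.sub_lt (by positivity) one_pos)
    · exact Nat.or_lt_two_pow (ih.trans_le (Nat.pow_le_pow_right two_pos (Nat.le_add_left _ _)))
        (Nat.shiftLeft_lt ih)

theorem testBit_truthTable {b k n : ℕ} (hb : b < k) (hn : n < 2 ^ k) :
    (truthTable b k).testBit n = n.testBit b := by
  induction k generalizing n with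
  | zero => omega
  | succ k ih =>
    rw [truthTable]
    rw [pow_succ] at hn
    split_ifs with h
    · subst h
      rw [Nat.testBit_shiftLeft, Nat.testBit_two_pow_sub_one]
      by_cases hlow : n < 2 ^ k
      · simp [Nat.testBit_lt_two_pow hlow, hlow]
      · obtain ⟨m, rfl⟩ := Nat.exists_eq_add_of_le (not_lt.1 hlow)
        rw [Nat.testBit_two_pow_add_eq, Nat.testBit_lt_two_pow (by omega)]
        grind
    · rw [Nat.testBit_or, Nat.testBit_shiftLeft]
      by_cases hlow : n < 2 ^ k
      · simp [ih (n := n) (by omega) hlow, hlow]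
      · obtain ⟨m, rfl⟩ := Nat.exists_eq_add_of_le (not_lt.1 hlow)
        rw [Nat.testBit_two_pow_add_gt (by omega), Nat.testBit_lt_two_pow
          ((truthTable_lt b k).trans_le (Nat.pow_le_pow_right two_pos (by omega)))]
        simp [ih (n := m) (by omega) (by omega)]

/-! ### Counting states of the chain -/

/-- The family of all states without cuts. -/
def allSlices : SlicedFamily where
  mask := 2 ^ 2 ^ 18 - 1
  layer j := truthTable (3 * j) 18
  entry j := truthTable (3 * j + 1) 18
  exit j := truthTable (3 * j + 2) 18

theorem testBit_mask_allSlices {n : ℕ} : allSlices.mask.testBit n ↔ n < 2 ^ 18 := by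
  simp only [allSlices, Nat.testBit_two_pow_sub_one, decide_eq_true_eq]

theorem allSlices_state {n : ℕ} (hn : n < 2 ^ 18) : allSlices.state n =
    { middle := fun j l => n.testBit (3 * j) = (l == 1)
      entry := fun j => n.testBit (3 * j + 1)
      exit := fun j => n.testBit (3 * j + 2)
      vert := fun _ => False } := by
  ext j
  all_goals simp only [SlicedFamily.state, allSlices]
  all_goals rw [testBit_truthTable (by omega) hn]

theorem injOn_allSlices_state : Set.InjOn allSlices.state {n | n < 2 ^ 18} := by
  intro m (hm : m < 2 ^ 18) n (hn : n < 2 ^ 18) h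
  rw [allSlices_state hm, allSlices_state hn, ChainState.mk.injEq] at h
  obtain ⟨hlayer, hentry, hexit, -⟩ := h
  refine Nat.eq_of_testBit_eq fun i => ?_
  by_cases hi : i < 18
  · obtain ⟨j, rfl | rfl | rfl⟩ : ∃ j : Fin 6, i = 3 * j ∨ i = 3 * j + 1 ∨ i = 3 * j + 2 :=
      ⟨⟨i / 3, by omega⟩, by simp only; omega⟩
    · simpa using congrFun (congrFun hlayer j) 1
    · simpa using congrFun hentry j
    · simpa using congrFun hexit j
  · have hpow : 2 ^ 18 ≤ 2 ^ i := Nat.pow_le_pow_right two_pos (by omega)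
    rw [Nat.testBit_lt_two_pow (by omega), Nat.testBit_lt_two_pow (by omega)]

theorem exists_allSlices_state_eq {s : ChainState} (hs : ¬ s.Cut) :
    ∃ n < 2 ^ 18, allSlices.state n = s := by
  classical
  simp only [ChainState.Cut, ChainState.Balanced, not_or, not_exists] at hs
  let bits : Fin (6 * 3) → Bool := fun i =>
    ![decide (s.middle i.divNat 1), decide (s.entry i.divNat), decide (s.exit i.divNat)] i.modNat
  have hbits : ∀ (j : Fin 6) (r : Fin 3), (Nat.ofBits bits).testBit (3 * j + r) =
      ![decide (s.middle j 1), decide (s.entry j), decide (s.exit j)] r := by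
    intro j r
    have hdiv : (3 * j.1 + r) / 3 = j := by omega
    have hmod : (3 * j.1 + r) % 3 = r := by omega
    rw [Nat.testBit_ofBits_lt _ _ (by omega)]
    simp [bits, Fin.divNat, Fin.modNat, hdiv, hmod]
  have hlt : Nat.ofBits bits < 2 ^ 18 := Nat.ofBits_lt_two_pow bits
  refine ⟨Nat.ofBits bits, hlt, (allSlices_state hlt).trans ?_⟩
  ext j l
  · have hlayer : (Nat.ofBits bits).testBit (3 * j) = decide (s.middle j 1) := hbits j 0
    have hj := hs.2 j
    revert l
    simp only [hlayer, Fin.forall_fin_two]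
    simp only [Fin.isValue, Fin.reduceBEq, decide_eq_false_iff_not, BEq.rfl, decide_eq_true_eq,
      and_true]
    tauto
  · exact (congrArg (· = true) (hbits j 1)).to_iff.trans decide_eq_true_iff
  · exact (congrArg (· = true) (hbits j 2)).to_iff.trans decide_eq_true_iff
  · simp [hs.1]

theorem ncard_not_cut_eq_popCount {P : ChainState → Prop} {x : ℕ}
    (h : ∀ n < 2 ^ 18, x.testBit n ↔ P (allSlices.state n)) :
    {s | ¬ s.Cut ∧ P s}.ncard = popCount 512 512 x := by
  have hbij : Set.BijOn allSlices.state {n | n < 512 * 512 ∧ x.testBit n} {s | ¬ s.Cut ∧ P s} := by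
    refine ⟨fun n hn => ⟨allSlices.not_cut_state n, (h n hn.1).1 hn.2⟩,
      injOn_allSlices_state.mono fun n hn => hn.1, fun s hs => ?_⟩
    obtain ⟨n, hn, rfl⟩ := exists_allSlices_state_eq hs.1
    exact ⟨n, ⟨hn, (h n hn).2 hs.2⟩, rfl⟩
  rw [popCount_eq_ncard (by decide +kernel), ← hbij.image_eq, hbij.injOn.ncard_image]

/-- A list of cells such that passing through them reaches every vertex that can be reached. -/
def sweep : List (Fin 6) := [0, 1, 2, 3, 4, 5, 4, 3, 2, 1, 0, 1, 2, 3, 4, 5, 4, 3, 2, 1, 0]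

section

set_option maxRecDepth 100000

theorem isClosed_reachBits_sweep : allSlices.IsClosed (allSlices.reachBits sweep) := by
  unfold SlicedFamily.IsClosed
  decide +kernel

theorem hits_allSlices_state_iff {n : ℕ} (hn : n < 2 ^ 18) (i : Fin 2) :
    (allSlices.state n).Hits i ↔ (allSlices.reachBits sweep (.inl 6) i).testBit n :=
  allSlices.hits_state_iff isClosed_reachBits_sweep (testBit_mask_allSlices.2 hn) i

theorem ncard_not_cut_hits (i : Fin 2) : {s : ChainState | ¬ s.Cut ∧ s.Hits i}.ncard =
    popCount 512 512 (allSlices.reachBits sweep (.inl 6) i) :=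
  ncard_not_cut_eq_popCount fun _ hn => (hits_allSlices_state_iff hn i).symm

theorem ncard_not_cut_preservesLayers_hits (i : Fin 2) :
    {s : ChainState | ¬ s.Cut ∧ s.PreservesLayers ∧ s.Hits i}.ncard =
      popCount 512 512 (allSlices.preserveBits (List.finRange 6) &&&
        allSlices.reachBits sweep (.inl 6) i) :=
  ncard_not_cut_eq_popCount fun n hn => by
    rw [Nat.testBit_and, Bool.and_eq_true, ← hits_allSlices_state_iff hn,
      SlicedFamily.testBit_preserveBits (testBit_mask_allSlices.2 hn)]
    simp [ChainState.PreservesLayers]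

-- A surplus of a single state would be too small for the 690 gadgets of `D7`.
theorem ncard_not_cut_hits_zero_add_le :
    {s : ChainState | ¬ s.Cut ∧ s.Hits 0}.ncard + 4 ≤
      {s : ChainState | ¬ s.Cut ∧ s.Hits 1}.ncard := by
  rw [ncard_not_cut_hits, ncard_not_cut_hits]
  decide +kernel

theorem ncard_not_cut_preservesLayers_hits_zero_lt :
    {s : ChainState | ¬ s.Cut ∧ s.PreservesLayers ∧ s.Hits 0}.ncard <
      {s : ChainState | ¬ s.Cut ∧ s.PreservesLayers ∧ s.Hits 1}.ncard := by
  rw [ncard_not_cut_preservesLayers_hits, ncard_not_cut_preservesLayers_hits]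
  decide +kernel

end

/-! ### Probabilities in the chain -/

section

open ChainState

theorem uniformProb_not_cut_hits_lt :
    uniformProb {s : ChainState | ¬ s.Cut ∧ s.PreservesLayers} (Hits · 0) <
      uniformProb {s : ChainState | ¬ s.Cut ∧ s.PreservesLayers} (Hits · 1) :=
  uniformProb_lt_of_ncard_lt (by
    simpa only [Set.mem_ofPred_eq, and_assoc] using ncard_not_cut_preservesLayers_hits_zero_lt)

theorem ncard_setOf_preservesLayers_not_vert_le :
    {s : ChainState | s.PreservesLayers ∧ ∀ q, ¬ s.vert q}.ncard ≤ 2 ^ 12 := by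
  have hcard : Nat.card (Fin 6 → Fin 2 → Prop) = 2 ^ 12 := by simp
  rw [← hcard, ← Set.ncard_univ]
  refine Set.ncard_le_ncard_of_injOn middle (fun _ _ => trivial) ?_
  rintro s ⟨hs, hs'⟩ t ⟨ht, ht'⟩ h
  ext j l
  · rw [h]
  all_goals simp_all [PreservesLayers]

theorem ncard_setOf_preservesLayers_le : {s : ChainState | s.PreservesLayers}.ncard ≤ 2 ^ 19 := by
  have hcard : Nat.card ((Fin 6 → Fin 2 → Prop) × (Fin 7 → Prop)) = 2 ^ 19 := by simp
  rw [← hcard, ← Set.ncard_univ]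
  refine Set.ncard_le_ncard_of_injOn (fun s => (s.middle, s.vert)) (fun _ _ => trivial) ?_
  intro s hs t ht h
  rw [Prod.mk.injEq] at h
  ext j l
  · rw [h.1]
  · simp [(hs j).1, (ht j).1]
  · simp [(hs j).2, (ht j).2]
  · rw [h.2]

theorem ncard_univ_chainState_le : (Set.univ : Set ChainState).ncard ≤ 2 ^ 31 := by
  have hcard : Nat.card ((Fin 6 → Fin 2 → Prop) × (Fin 6 → Prop) × (Fin 6 → Prop) ×
    (Fin 7 → Prop)) = 2 ^ 31 := by simp
  rw [← hcard, Set.ncard_univ]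
  exact Nat.card_le_card_of_injective _ injective_toProd

theorem uniformProb_hits_add_le_of_preservesLayers_of_not_vert :
    uniformProb {s : ChainState | s.PreservesLayers ∧ ∀ q, ¬ s.vert q} (Hits · 0) + 1 / 2 ^ 12 ≤
      uniformProb {s : ChainState | s.PreservesLayers ∧ ∀ q, ¬ s.vert q} (Hits · 1) := by
  have hnotcut : ∀ i, {s ∈ {s : ChainState | s.PreservesLayers ∧ ∀ q, ¬ s.vert q} |
      ¬ s.Cut ∧ s.Hits i} = {s | ¬ s.Cut ∧ s.PreservesLayers ∧ s.Hits i} := by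
    intro i
    ext s
    simp only [Set.mem_ofPred_eq, Cut]
    grind
  have h := ncard_hits_le_of_not_cut (𝒮 := {s | s.PreservesLayers ∧ ∀ q, ¬ s.vert q})
    (fun _ _ hs => hs) (m := 1) (by
      rw [hnotcut, hnotcut]
      exact ncard_not_cut_preservesLayers_hits_zero_lt)
  exact_mod_cast uniformProb_add_div_le h ncard_setOf_preservesLayers_not_vert_le

theorem uniformProb_hits_add_le_of_preservesLayers :
    uniformProb {s : ChainState | s.PreservesLayers} (Hits · 0) + 1 / 2 ^ 19 ≤
      uniformProb {s : ChainState | s.PreservesLayers} (Hits · 1) := by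
  have h := ncard_hits_le_of_not_cut (𝒮 := {s | s.PreservesLayers}) (fun _ _ hs => hs) (m := 1) (by
    simpa only [Set.mem_ofPred_eq, and_left_comm, Nat.add_one_le_iff]
      using ncard_not_cut_preservesLayers_hits_zero_lt)
  exact_mod_cast uniformProb_add_div_le h ncard_setOf_preservesLayers_le

theorem uniformProb_hits_add_le :
    uniformProb (Set.univ : Set ChainState) (Hits · 0) + 4 / 2 ^ 31 ≤
      uniformProb (Set.univ : Set ChainState) (Hits · 1) := by
  have h := ncard_hits_le_of_not_cut (𝒮 := Set.univ) (fun _ _ _ => trivial) (m := 4) (by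
    simpa only [Set.mem_univ, true_and] using ncard_not_cut_hits_zero_add_le)
  exact_mod_cast uniformProb_add_div_le h ncard_univ_chainState_le

end

/-! ### The hypergraphs `H4` and `H5` -/

section

open ChainState

/-- The vertices of the chain as vertices of `H4`: the path is `u₁ u₃ u₄ u₅ u₆ u₈ u₁₀`, and the
posts are `u₂`, `u₉`, `u₇`. -/
def chainEquiv : ChainVertex ≃ Fin 10 where
  toFun := Sum.elim ![0, 2, 3, 4, 5, 7, 9] ![1, 8, 6]
  invFun := ![.inl 0, .inr 0, .inl 1, .inl 2, .inl 3, .inl 4, .inr 2, .inl 5, .inr 1, .inl 6]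
  left_inv := by unfold Function.LeftInverse; decide
  right_inv := by unfold Function.RightInverse Function.LeftInverse; decide

theorem nat_card_T4 : Nat.card T4 = 3 := by
  rw [Nat.card_coe_set_eq, T4, Set.ncard_eq_toFinset_card']
  rfl

/-- The vertices of the chain as elements of the vertex set of `H4`. -/
def vertexEquiv : ChainVertex ≃ H4.vertexSet := chainEquiv.trans (Equiv.Set.univ _).symm

theorem vertexEquiv_mem_T4 {v : ChainVertex} : (vertexEquiv v).1 ∈ T4 ↔ v.isRight := by
  change chainEquiv v ∈ ({1, 6, 8} : Set (Fin 10)) ↔ _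
  simp only [Set.mem_insert_iff, Set.mem_singleton_iff]
  revert v; decide

theorem image_chainMem_eq (j : Fin 6) : chainEquiv '' {v | ChainMem j v} =
    {chainEquiv (.inl j.castSucc), chainEquiv (.inl j.succ), chainEquiv (.inr (cellPost j))} := by
  have h : {v | ChainMem j v} = {.inl j.castSucc, .inl j.succ, .inr (cellPost j)} := by
    ext v; simp [ChainMem]
  simp only [h, Set.image_insert_eq, Set.image_singleton]

theorem range_image_chainMem :
    Set.range (fun j => chainEquiv '' {v | ChainMem j v}) = H4.edgeSet := by
  have h : (fun j => chainEquiv '' {v | ChainMem j v}) =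
      ![{0, 2, 1}, {2, 3, 8}, {3, 4, 6}, {4, 5, 1}, {5, 7, 6}, {7, 9, 8}] := by
    funext j
    rw [image_chainMem_eq]
    fin_cases j <;> rfl
  have hpair : ({0, 2, 1} : Set (Fin 10)) = {0, 1, 2} := by rw [Set.pair_comm]
  rw [h, hpair]
  ext e
  simp only [Matrix.range_cons, Matrix.range_empty, H4, Set.union_empty, Set.mem_union,
    Set.mem_singleton_iff, Set.mem_insert_iff]

theorem injective_image_chainMem :
    Function.Injective fun j => chainEquiv '' {v | ChainMem j v} := by
  intro i j h
  have hmem : ∀ v, ChainMem i v ↔ ChainMem j v :=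
    Set.ext_iff.1 (chainEquiv.injective.image_injective h)
  revert hmem; clear h; revert i j; decide

/-- The hyperedges of `H4` are the cells. -/
noncomputable def cellEdge : Fin 6 ≃ H4.edgeSet :=
  (Equiv.ofInjective _ injective_image_chainMem).trans (Equiv.setCongr range_image_chainMem)

theorem chainEquiv_mem_cellEdge {j : Fin 6} {v : ChainVertex} :
    chainEquiv v ∈ (cellEdge j).1 ↔ ChainMem j v :=
  chainEquiv.injective.mem_set_image

/-- The edges of the bunkbed of a hypergraph, with `Net.Edge` unfolded. -/
abbrev HyperBEdge {α : Type} (H : Hypergraph α) : Type := (H.edgeSet × Fin 2) ⊕ H.vertexSet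

/-- The state of the chain that describes a set of edges of the bunkbed of `H4`. -/
noncomputable def hypergraphState (X : Set (HyperBEdge H4)) : ChainState where
  middle j l := .inl (cellEdge j, l) ∈ X
  entry _ := False
  exit _ := False
  vert q := .inr (vertexEquiv (.inl q)) ∈ X

/-- The vertical edges at `T4`. -/
def hypergraphPosts : Set (HyperBEdge H4) := Sum.inr '' {v | v.1 ∈ T4}

variable {X : Set (HyperBEdge H4)}

theorem hypergraphPosts_subset_iff :
    hypergraphPosts ⊆ X ↔ ∀ t, .inr (vertexEquiv (.inr t)) ∈ X := by
  rw [hypergraphPosts, Set.image_subset_iff, Set.subset_def, vertexEquiv.surjective.forall]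
  simp [vertexEquiv_mem_T4]

theorem vertAt_hypergraphState (hX : hypergraphPosts ⊆ X) {v : ChainVertex} :
    (hypergraphState X).VertAt v ↔ .inr (vertexEquiv v) ∈ X := by
  rcases v with q | t
  exacts [Iff.rfl, iff_of_true trivial (hypergraphPosts_subset_iff.1 hX t)]

theorem preservesLayers_hypergraphState (X : Set (HyperBEdge H4)) :
    (hypergraphState X).PreservesLayers := fun _ => ⟨id, id⟩

theorem conn_hypergraph_iff_hits (hX : hypergraphPosts ⊆ X) (i : Fin 2) :
    Conn (bunkbed (ofHypergraph H4)) X (H4vertex 0, 0) (H4vertex 9, i) ↔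
      (hypergraphState X).Hits i := by
  refine reflTransGen_iff_of_retraction (f := Prod.map vertexEquiv id)
    (g := Prod.map vertexEquiv.symm id) (vertexEquiv.left_inv.prodMap fun _ => rfl) ?_ ?_
    (a := (.inl 0, 0)) (b := (.inl 6, i))
  · rintro ⟨v, l⟩ ⟨w, m⟩ (⟨j, hv, hw, hp⟩ | ⟨rfl : v = w, hv⟩)
    · obtain ⟨rfl : l = m, hmid⟩ := (preservesLayers_hypergraphState X).passes_iff.1 hp
      exact .single (step_bunkbed_of_joins hmid
        ⟨chainEquiv_mem_cellEdge.2 hv, chainEquiv_mem_cellEdge.2 hw⟩)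
    · exact conn_bunkbed_of_vertical ((vertAt_hypergraphState hX).1 hv) l m
  · rintro ⟨a, l⟩ ⟨b, m⟩ h
    obtain ⟨v, rfl⟩ := vertexEquiv.surjective a
    obtain ⟨w, rfl⟩ := vertexEquiv.surjective b
    simp only [Prod.map, Equiv.symm_apply_apply, id_eq]
    refine .single ?_
    rcases step_bunkbed.1 h with ⟨rfl, e, he, hv, hw⟩ | ⟨hvw, -, hv⟩
    · obtain ⟨j, rfl⟩ := cellEdge.surjective e
      exact .inl ⟨j, chainEquiv_mem_cellEdge.1 hv, chainEquiv_mem_cellEdge.1 hw,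
        (preservesLayers_hypergraphState X).passes_iff.2 ⟨rfl, he⟩⟩
    · exact .inr ⟨vertexEquiv.injective hvw, (vertAt_hypergraphState hX).2 hv⟩

theorem bijOn_hypergraphState :
    Set.BijOn hypergraphState {X | hypergraphPosts ⊆ X} {s | s.PreservesLayers} := by
  refine ⟨fun X _ => preservesLayers_hypergraphState X, fun X hX Y hY h => ?_, fun s hs => ?_⟩
  · rw [ChainState.ext_iff] at h
    ext e
    rcases e with ⟨e, l⟩ | v
    · obtain ⟨j, rfl⟩ := cellEdge.surjective e
      exact iff_of_eq (congrFun₂ h.1 j l)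
    · obtain ⟨q | t, rfl⟩ := vertexEquiv.surjective v
      · exact iff_of_eq (congrFun h.2.2.2 q)
      · exact iff_of_true (hypergraphPosts_subset_iff.1 hX t) (hypergraphPosts_subset_iff.1 hY t)
  · refine ⟨{e | Sum.elim (fun p => s.middle (cellEdge.symm p.1) p.2)
      (fun v => s.VertAt (vertexEquiv.symm v)) e}, hypergraphPosts_subset_iff.2 fun t => ?_, ?_⟩
    · simp [VertAt]
    · ext j <;> simp [hypergraphState, VertAt, (hs _).1, (hs _).2]

theorem mem_E4_outcomes : X ∈ (E4 H4 {v | v.1 ∈ T4}).outcomes ↔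
    hypergraphPosts ⊆ X ∧ ¬ (hypergraphState X).Cut := by
  have hvert : (∀ v, .inr v ∈ X ↔ v.1 ∈ T4) ↔
      hypergraphPosts ⊆ X ∧ ∀ q, ¬ (hypergraphState X).vert q := by
    rw [hypergraphPosts_subset_iff, vertexEquiv.surjective.forall, Sum.forall, and_comm]
    simp [vertexEquiv_mem_T4, hypergraphState]
  rw [not_cut_iff, ← and_assoc, ← hvert, and_comm]
  exact and_congr_left' cellEdge.surjective.forall

theorem E4_prob_lt : (E4 H4 {v | v.1 ∈ T4}).prob (H4vertex 0, 0) (H4vertex 9, 0) <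
    (E4 H4 {v | v.1 ∈ T4}).prob (H4vertex 0, 0) (H4vertex 9, 1) := by
  have hbij : Set.BijOn hypergraphState (E4 H4 {v | v.1 ∈ T4}).outcomes
      {s | ¬ s.Cut ∧ s.PreservesLayers} := by
    have houtcomes : (E4 H4 {v | v.1 ∈ T4}).outcomes = {X | hypergraphPosts ⊆ X} ∩
        hypergraphState ⁻¹' {s | ¬ s.Cut ∧ s.PreservesLayers} := Set.ext fun X =>
      mem_E4_outcomes.trans (and_congr_right fun _ =>
        (and_iff_left (preservesLayers_hypergraphState X)).symm)
    rw [houtcomes]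
    exact bijOn_hypergraphState.subset_right fun s hs => hs.2
  have hprob : ∀ i, (E4 H4 {v | v.1 ∈ T4}).prob (H4vertex 0, 0) (H4vertex 9, i) =
      uniformProb {s | ¬ s.Cut ∧ s.PreservesLayers} (Hits · i) := fun i =>
    uniformProb_eq_of_bijOn hbij fun X hX => conn_hypergraph_iff_hits (mem_E4_outcomes.1 hX).1 i
  rw [hprob, hprob]
  exact uniformProb_not_cut_hits_lt

end

section

/-- The hyperedge of `H5` that comes from a hyperedge of `H4`. -/
def coreHyperedge (e : H4.edgeSet) : H5.edgeSet := ⟨Sum.inl '' e.1, .inl ⟨e.1, e.2, rfl⟩⟩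

/-- The vertex of `H5` that comes from a vertex of `H4`. -/
def coreVertex (v : H4.vertexSet) : H5.vertexSet := H5vertex v.1

/-- The pendant edges of `H5`. -/
def pendantEdge (p : T4 × Fin 102) : H5.edgeSet :=
  ⟨{Sum.inl p.1.1, Sum.inr p}, .inr ⟨p.1, p.2, rfl⟩⟩

/-- The leaves of `H5`. -/
def pendantVertex (p : T4 × Fin 102) : H5.vertexSet := ⟨.inr p, trivial⟩

/-- Contract the pendant edges of `H5`. -/
def contractPendant (x : H5.vertexSet) : H4.vertexSet := H4vertex (Sum.elim id (·.1.1) x.1)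

theorem injective_coreHyperedge : Function.Injective coreHyperedge := fun _ _ h =>
  Subtype.ext (Sum.inl_injective.image_injective (congrArg Subtype.val h))

theorem injective_coreVertex : Function.Injective coreVertex := fun _ _ h =>
  Subtype.ext (Sum.inl_injective (congrArg Subtype.val h))

theorem inr_mem_pendantEdge {p q : T4 × Fin 102} : .inr p ∈ (pendantEdge q).1 ↔ p = q := by
  simp [pendantEdge]

theorem injective_pendantEdge : Function.Injective pendantEdge := fun p _ h =>
  inr_mem_pendantEdge.1 (h ▸ inr_mem_pendantEdge.2 (rfl : p = p))

theorem injective_pendantVertex : Function.Injective pendantVertex := fun _ _ h =>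
  Sum.inr_injective (congrArg Subtype.val h)

theorem coreHyperedge_ne_pendantEdge (e : H4.edgeSet) (p : T4 × Fin 102) :
    coreHyperedge e ≠ pendantEdge p := by
  intro h
  obtain ⟨_, _, hp⟩ : .inr p ∈ (coreHyperedge e).1 := h ▸ inr_mem_pendantEdge.2 rfl
  cases hp

theorem coreVertex_ne_pendantVertex (v : H4.vertexSet) (p : T4 × Fin 102) :
    coreVertex v ≠ pendantVertex p := fun h => Sum.inl_ne_inr (congrArg Subtype.val h)

theorem nat_card_H5_vertexSet : Nat.card H5.vertexSet = 316 := by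
  have huniv : Nat.card H5.vertexSet = Nat.card (Fin 10 ⊕ (T4 × Fin 102)) := Nat.card_univ
  rw [huniv, Nat.card_sum, Nat.card_prod, nat_card_T4, Nat.card_fin, Nat.card_fin]

/-- The edge of the bunkbed of `H5` that comes from an edge of the bunkbed of `H4`. -/
def coreBEdge : ↥hypergraphPostsᶜ → HyperBEdge H5 :=
  fun e => Sum.map (Prod.map coreHyperedge id) coreVertex e.1

theorem injective_coreBEdge : Function.Injective coreBEdge :=
  ((injective_coreHyperedge.prodMap Function.injective_id).sumMap injective_coreVertex).comp
    Subtype.val_injective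

/-- The ways of changing the layer at `t`: along its own vertical edge, or along that of a leaf. -/
def pendantBlock (t : T4) : Option (Fin 102) → Set (HyperBEdge H5)
  | none => {.inr (H5vertex t)}
  | some i => {.inl (pendantEdge (t, i), 0), .inl (pendantEdge (t, i), 1),
      .inr (pendantVertex (t, i))}

theorem disjoint_pendantBlock (t : T4) :
    Pairwise fun i j => Disjoint (pendantBlock t i) (pendantBlock t j) := by
  have hne : ∀ i, H5vertex t ≠ pendantVertex (t, i) := fun i =>
    coreVertex_ne_pendantVertex (H4vertex t) (t, i)
  rintro (_ | i) (_ | j) hij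
  · exact absurd rfl hij
  · simp [pendantBlock, hne]
  · simp [pendantBlock, hne]
  · simp only [ne_eq, Option.some.injEq] at hij
    simp [pendantBlock, injective_pendantEdge.eq_iff, injective_pendantVertex.eq_iff,
      Ne.symm hij]

theorem disjoint_range_coreBEdge_pendantBlock (t : T4) (i : Option (Fin 102)) :
    Disjoint (Set.range coreBEdge) (pendantBlock t i) := by
  rw [Set.disjoint_left]
  rintro _ ⟨⟨⟨e, l⟩ | v, hv⟩, rfl⟩ h <;> rcases i with _ | i
  · simp [coreBEdge, pendantBlock] at h
  · simp [coreBEdge, pendantBlock, coreHyperedge_ne_pendantEdge] at h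
  · obtain rfl : v = H4vertex t := injective_coreVertex (Sum.inr_injective h)
    exact hv ⟨_, t.2, rfl⟩
  · simp [coreBEdge, pendantBlock, coreVertex_ne_pendantVertex] at h

theorem ncard_pendantBlock_some (t : T4) (i : Fin 102) : (pendantBlock t (some i)).ncard = 3 :=
  Set.ncard_eq_three.2 ⟨_, _, _, by simp, by simp, by simp, rfl⟩

variable {X : Set (HyperBEdge H5)}

theorem conn_of_containsBlocks_pendantBlock (hX : ContainsBlocks pendantBlock X) (t : T4)
    (l m : Fin 2) : Conn (bunkbed (ofHypergraph H5)) X (H5vertex t, l) (H5vertex t, m) := by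
  obtain ⟨_ | i, hi⟩ := hX t
  · exact conn_bunkbed_of_vertical (hi rfl) l m
  · have hpendant : ∀ l, .inl (pendantEdge (t, i), l) ∈ X := by
      rw [Fin.forall_fin_two]
      exact ⟨hi (.inl rfl), hi (.inr (.inl rfl))⟩
    have hvert : Conn (bunkbed (ofHypergraph H5)) X (pendantVertex (t, i), l)
        (pendantVertex (t, i), m) := conn_bunkbed_of_vertical (hi (.inr (.inr rfl))) l m
    have hjoins : (ofHypergraph H5).Joins (pendantEdge (t, i)) (H5vertex t)
        (pendantVertex (t, i)) := ⟨.inl rfl, .inr rfl⟩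
    exact .head (step_bunkbed_of_joins (hpendant l) hjoins)
      (hvert.tail (step_bunkbed_of_joins (hpendant m) hjoins.symm))

theorem conn_H5_iff (hX : ContainsBlocks pendantBlock X) {u v : H4.vertexSet} {l m : Fin 2} :
    Conn (bunkbed (ofHypergraph H5)) X (coreVertex u, l) (coreVertex v, m) ↔
      Conn (bunkbed (ofHypergraph H4)) (trace coreBEdge X) (u, l) (v, m) := by
  refine reflTransGen_iff_of_retraction (f := Prod.map coreVertex id)
    (g := Prod.map contractPendant id) (fun _ => rfl) ?_ ?_ (a := (u, l)) (b := (v, m))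
  · rintro ⟨v, l⟩ ⟨w, m⟩ h
    rcases step_bunkbed.1 h with ⟨rfl, e, he, hv, hw⟩ | ⟨rfl, -, hv⟩
    · exact .single (step_bunkbed_of_joins (mem_trace.1 he fun ⟨_, _, h⟩ => Sum.inr_ne_inl h)
        ⟨⟨_, hv, rfl⟩, ⟨_, hw, rfl⟩⟩)
    · by_cases hT : v.1 ∈ T4
      · exact conn_of_containsBlocks_pendantBlock hX ⟨v.1, hT⟩ l m
      · refine conn_bunkbed_of_vertical (mem_trace.1 hv ?_) l m
        rintro ⟨_, hT', h⟩
        exact hT (Sum.inr_injective h ▸ hT')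
  · rintro ⟨x, l⟩ ⟨y, m⟩ h
    rcases step_bunkbed.1 h with ⟨rfl, ⟨_, ⟨f, hf, rfl⟩ | ⟨t, i, rfl⟩⟩, he, hx, hy⟩ |
      ⟨rfl, -, hx⟩
    · obtain ⟨_, _⟩ := x
      obtain ⟨_, _⟩ := y
      obtain ⟨a, ha, rfl⟩ := hx
      obtain ⟨b, hb, rfl⟩ := hy
      exact .single (step_bunkbed_of_joins (e := ⟨f, hf⟩) (mem_trace.2 fun _ => he) ⟨ha, hb⟩)
    · have hcontract : ∀ z : H5.vertexSet, z.1 ∈ ({.inl t.1, .inr (t, i)} : Set _) →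
          contractPendant z = H4vertex t := by
        rintro ⟨_, -⟩ (rfl | rfl) <;> rfl
      simp only [Prod.map, hcontract x hx, hcontract y hy, id_eq]
      exact .refl
    · refine conn_bunkbed_of_vertical (mem_trace.2 fun hT => ?_) l m
      obtain ⟨u | p, _⟩ := x
      exacts [hx, absurd ⟨_, p.1.2, rfl⟩ hT]

set_option exponentiation.threshold 1000 in
theorem E5_prob_lt : (E5 H5).prob (H5vertex 0, 0) (H5vertex 9, 0) <
    (E5 H5).prob (H5vertex 0, 0) (H5vertex 9, 1) := by
  have := Fintype.ofFinite T4
  have hcard : Fintype.card T4 = 3 := by rw [← Nat.card_eq_fintype_card, nat_card_T4]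
  have hfin : Finite (HyperBEdge H5) :=
    inferInstanceAs (Finite ((H5.edgeSet × Fin 2) ⊕ H5.vertexSet))
  have hprob : ∀ i, uniformProb {Y | hypergraphPosts ⊆ Y}
      (fun Y => Conn (bunkbed (ofHypergraph H4)) Y (H4vertex 0, 0) (H4vertex 9, i)) =
        uniformProb {s | s.PreservesLayers} (ChainState.Hits · i) := fun i =>
    uniformProb_eq_of_bijOn bijOn_hypergraphState fun X hX => conn_hypergraph_iff_hits hX i
  refine randomSetProb_lt_of_blocks injective_coreBEdge disjoint_pendantBlock
    disjoint_range_coreBEdge_pendantBlock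
    (R₀ := fun Y => Conn (bunkbed (ofHypergraph H4)) Y (H4vertex 0, 0) (H4vertex 9, 0))
    (R₁ := fun Y => Conn (bunkbed (ofHypergraph H4)) Y (H4vertex 0, 0) (H4vertex 9, 1))
    (fun _ hX => conn_H5_iff hX (u := H4vertex 0) (v := H4vertex 9))
    (fun _ hX => conn_H5_iff hX (u := H4vertex 0) (v := H4vertex 9))
    (d := 1 / 2 ^ 19) (by positivity) ?_ ?_
  · rw [hprob, hprob]
    exact uniformProb_hits_add_le_of_preservesLayers
  · simp only [Fintype.prod_option, ncard_pendantBlock_some]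
    simp only [pendantBlock, Set.ncard_singleton, Finset.prod_const, Finset.sum_const,
      Finset.card_univ, hcard, Fintype.card_fin]
    norm_num

end

/-! ### The digraph `D6` -/

section

open ChainState

/-- The edges of the bunkbed of a digraph, with `Net.Edge` unfolded. -/
abbrev DigraphBEdge {V : Type} (D : Digraph V) : Type := (DEdge D × Fin 2) ⊕ V

/-- The edges of the bunkbed of `D` which are retained for certain in the model `E6 D T F`. -/
def certainEdges {V : Type} {D : Digraph V} (T : Set V) (F : Set (DEdge D)) :
    Set (DigraphBEdge D) :=
  Sum.inl '' {p | p.1 ∈ F} ∪ Sum.inr '' T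

theorem inl_mem_certainEdges {V : Type} {D : Digraph V} {T : Set V} {F : Set (DEdge D)}
    {e : DEdge D} {l : Fin 2} : .inl (e, l) ∈ certainEdges T F ↔ e ∈ F := by
  simp [certainEdges]

theorem inr_mem_certainEdges {V : Type} {D : Digraph V} {T : Set V} {F : Set (DEdge D)} {v : V} :
    .inr v ∈ certainEdges T F ↔ v ∈ T := by
  simp [certainEdges]

/-- The edge `x_f y_f` of `D6`. -/
def middleEdge (f : H4.edgeSet) : DEdge D6 := ⟨(.x f, .y f), .middle f⟩

theorem middleEdge_inj {f g : H4.edgeSet} : middleEdge f = middleEdge g ↔ f = g :=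
  ⟨fun h => D6Vertex.x.inj (congrArg (·.1.1) h), congrArg middleEdge⟩

theorem notMem_F6_iff {e : DEdge D6} : e ∉ F6 ↔ ∃ f, e = middleEdge f := by
  simp [F6, middleEdge, Subtype.ext_iff]

theorem enter_mem_F6 {u : Fin 10} {f : H4.edgeSet} (h : u ∈ f.1) :
    (⟨(.old u, .x f), .enter u f h⟩ : DEdge D6) ∈ F6 := by simp [F6]

theorem leave_mem_F6 {u : Fin 10} {f : H4.edgeSet} (h : u ∈ f.1) :
    (⟨(.y f, .old u), .leave u f h⟩ : DEdge D6) ∈ F6 := by simp [F6]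

theorem old_mem_T6 {v : ChainVertex} : .old (chainEquiv v) ∈ T6 ↔ v.isRight :=
  (show Function.Injective D6Vertex.old from fun _ _ => D6Vertex.old.inj).mem_set_image.trans
    vertexEquiv_mem_T4

theorem mem_hyperedge_iff_chainMem {u : Fin 10} {f : H4.edgeSet} :
    u ∈ f.1 ↔ ChainMem (cellEdge.symm f) (chainEquiv.symm u) := by
  simp [← chainEquiv_mem_cellEdge]

/-- The state of the chain that describes a set of edges of the bunkbed of `D6`. -/
noncomputable def digraphState (X : Set (DigraphBEdge D6)) : ChainState where
  middle j l := .inl (middleEdge (cellEdge j), l) ∈ X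
  entry j := .inr (.x (cellEdge j)) ∈ X
  exit j := .inr (.y (cellEdge j)) ∈ X
  vert q := .inr (.old (chainEquiv (.inl q))) ∈ X

variable {X : Set (DigraphBEdge D6)}

theorem middle_digraphState {f : H4.edgeSet} {l : Fin 2} :
    (digraphState X).middle (cellEdge.symm f) l ↔ .inl (middleEdge f, l) ∈ X := by
  simp [digraphState]

theorem entry_digraphState {f : H4.edgeSet} :
    (digraphState X).entry (cellEdge.symm f) ↔ .inr (.x f) ∈ X := by
  simp [digraphState]

theorem exit_digraphState {f : H4.edgeSet} :
    (digraphState X).exit (cellEdge.symm f) ↔ .inr (.y f) ∈ X := by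
  simp [digraphState]

theorem vertAt_digraphState (hX : certainEdges T6 F6 ⊆ X) {v : ChainVertex} :
    (digraphState X).VertAt v ↔ .inr (.old (chainEquiv v)) ∈ X := by
  rcases v with q | t
  exacts [Iff.rfl, iff_of_true trivial (hX (inr_mem_certainEdges.2 (old_mem_T6.2 rfl)))]

theorem conn_digraph_of_passes (hX : certainEdges T6 F6 ⊆ X) {j : Fin 6} {v w : ChainVertex}
    {l m : Fin 2} (hv : ChainMem j v) (hw : ChainMem j w) (h : (digraphState X).Passes j l m) :
    Conn (bunkbed (ofDigraph D6)) X (.old (chainEquiv v), l) (.old (chainEquiv w), m) := by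
  obtain ⟨k, hentry, hmiddle, hexit⟩ := h
  have hchange : ∀ {a : D6Vertex} {l m : Fin 2}, (l = m ∨ .inr a ∈ X) →
      Conn (bunkbed (ofDigraph D6)) X (a, l) (a, m) := by
    rintro a l m (rfl | ha)
    exacts [.refl, conn_bunkbed_of_vertical ha l m]
  have henter : Step (bunkbed (ofDigraph D6)) X (.old (chainEquiv v), l) (.x (cellEdge j), l) :=
    step_bunkbed_of_joins
      (hX (inl_mem_certainEdges.2 (enter_mem_F6 (chainEquiv_mem_cellEdge.2 hv)))) rfl
  have hcross : Step (bunkbed (ofDigraph D6)) X (.x (cellEdge j), k) (.y (cellEdge j), k) :=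
    step_bunkbed_of_joins hmiddle rfl
  have hleave : Step (bunkbed (ofDigraph D6)) X (.y (cellEdge j), m) (.old (chainEquiv w), m) :=
    step_bunkbed_of_joins
      (hX (inl_mem_certainEdges.2 (leave_mem_F6 (chainEquiv_mem_cellEdge.2 hw)))) rfl
  exact .head henter ((hchange hentry).trans (.head hcross ((hchange hexit).tail hleave)))

/-- What reachability of a vertex of the bunkbed of `D6` means for the chain: a vertex `x_f` or
`y_f` is reached from some vertex of the cell `f`. -/
def ChainReaches (s : ChainState) (p : ChainVertex × Fin 2) : D6Vertex × Fin 2 → Prop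
  | (.old u, l) => s.Reach p (chainEquiv.symm u, l)
  | (.x f, l) => ∃ v m, ChainMem (cellEdge.symm f) v ∧ s.Reach p (v, m) ∧
      (m = l ∨ s.entry (cellEdge.symm f))
  | (.y f, l) => ∃ v m, ChainMem (cellEdge.symm f) v ∧ s.Reach p (v, m) ∧
      s.Passes (cellEdge.symm f) m l

theorem chainReaches_of_step (hX : certainEdges T6 F6 ⊆ X) {p : ChainVertex × Fin 2}
    {a b : D6Vertex × Fin 2} (hab : Step (bunkbed (ofDigraph D6)) X a b)
    (ha : ChainReaches (digraphState X) p a) : ChainReaches (digraphState X) p b := by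
  obtain ⟨a, l⟩ := a
  obtain ⟨b, m⟩ := b
  rcases step_bunkbed.1 hab with ⟨rfl, ⟨_, hadj⟩, he, rfl⟩ | ⟨rfl, -, hvert⟩
  · cases hadj with
    | enter u f hu => exact ⟨_, l, mem_hyperedge_iff_chainMem.1 hu, ha, .inl rfl⟩
    | middle f =>
      obtain ⟨v, k, hv, hreach, hentry⟩ := ha
      exact ⟨v, k, hv, hreach, l, hentry, middle_digraphState.2 he, .inl rfl⟩
    | leave u f hu =>
      obtain ⟨v, k, hv, hreach, hpass⟩ := ha
      exact hreach.tail (.inl ⟨_, hv, mem_hyperedge_iff_chainMem.1 hu, hpass⟩)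
  · cases a with
    | old u =>
      obtain ⟨v, rfl⟩ := chainEquiv.surjective u
      rw [ChainReaches, chainEquiv.symm_apply_apply] at ha ⊢
      exact .tail ha (step_of_vertAt ((vertAt_digraphState hX).2 hvert) l m)
    | x f =>
      obtain ⟨v, k, hv, hreach, -⟩ := ha
      exact ⟨v, k, hv, hreach, .inr (entry_digraphState.2 hvert)⟩
    | y f =>
      obtain ⟨v, k, hv, hreach, i, hentry, hmiddle, -⟩ := ha
      exact ⟨v, k, hv, hreach, i, hentry, hmiddle, .inr (exit_digraphState.2 hvert)⟩

theorem conn_digraph_iff_hits (hX : certainEdges T6 F6 ⊆ X) (i : Fin 2) :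
    Conn (bunkbed (ofDigraph D6)) X (.old 0, 0) (.old 9, i) ↔ (digraphState X).Hits i := by
  constructor
  · exact fun h => reflTransGen_preserves (P := ChainReaches (digraphState X) (.inl 0, 0))
      (fun _ _ => chainReaches_of_step hX) h Relation.ReflTransGen.refl
  · refine Relation.ReflTransGen.lift'
      (fun p : ChainVertex × Fin 2 => (D6Vertex.old (chainEquiv p.1), p.2)) ?_ _ _
    rintro ⟨v, l⟩ ⟨w, m⟩ (⟨j, hv, hw, hpass⟩ | ⟨rfl : v = w, hv⟩)
    exacts [conn_digraph_of_passes hX hv hw hpass,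
      conn_bunkbed_of_vertical ((vertAt_digraphState hX).1 hv) l m]

/-- The set of edges of the bunkbed of `D6` which is described by a state of the chain. -/
def digraphEdges (s : ChainState) : Set (DigraphBEdge D6) :=
  {e | match e with
    | .inl (e, l) => ∀ f, e = middleEdge f → s.middle (cellEdge.symm f) l
    | .inr (.old u) => s.VertAt (chainEquiv.symm u)
    | .inr (.x f) => s.entry (cellEdge.symm f)
    | .inr (.y f) => s.exit (cellEdge.symm f)}

theorem certainEdges_subset_digraphEdges (s : ChainState) :
    certainEdges T6 F6 ⊆ digraphEdges s := by
  rintro _ (⟨⟨e, l⟩, he, rfl⟩ | ⟨_, ⟨u, hu, rfl⟩, rfl⟩)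
  · exact fun f hf => absurd he (notMem_F6_iff.2 ⟨f, hf⟩)
  · obtain ⟨q | t, rfl⟩ := chainEquiv.surjective u
    · exact absurd (vertexEquiv_mem_T4.1 hu) Bool.false_ne_true
    · simp [digraphEdges, VertAt]

theorem digraphState_digraphEdges (s : ChainState) : digraphState (digraphEdges s) = s := by
  ext <;> simp [digraphState, digraphEdges, middleEdge_inj, VertAt, -Subtype.forall]

theorem bijOn_digraphState :
    Set.BijOn digraphState {X | certainEdges T6 F6 ⊆ X} Set.univ := by
  refine ⟨fun _ _ => trivial, fun X hX Y hY h => ?_, fun s _ =>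
    ⟨digraphEdges s, certainEdges_subset_digraphEdges s, digraphState_digraphEdges s⟩⟩
  obtain ⟨hmiddle, hentry, hexit, -⟩ := ChainState.ext_iff.1 h
  ext e
  by_cases he : e ∈ certainEdges T6 F6
  · exact iff_of_true (hX he) (hY he)
  · rcases e with ⟨e, l⟩ | (u | f | f)
    · obtain ⟨f, rfl⟩ := notMem_F6_iff.1 (inl_mem_certainEdges.not.1 he)
      obtain ⟨j, rfl⟩ := cellEdge.surjective f
      exact iff_of_eq (congrFun₂ hmiddle j l)
    · obtain ⟨v, rfl⟩ := chainEquiv.surjective u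
      rw [← vertAt_digraphState hX, ← vertAt_digraphState hY, h]
    all_goals obtain ⟨j, rfl⟩ := cellEdge.surjective f
    exacts [iff_of_eq (congrFun hentry j), iff_of_eq (congrFun hexit j)]

theorem mem_E6_outcomes : X ∈ (E6 D6 T6 F6).outcomes ↔ certainEdges T6 F6 ⊆ X ∧
    ¬ (digraphState X).Cut ∧ (digraphState X).PreservesLayers := by
  rw [not_cut_iff]
  constructor
  · rintro ⟨hedge, hvert⟩
    refine ⟨?_, ⟨fun q hq => ?_, fun j => ?_⟩, fun j => ⟨fun h => ?_, fun h => ?_⟩⟩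
    · rintro _ (⟨⟨e, l⟩, he, rfl⟩ | ⟨v, hv, rfl⟩)
      · exact Fin.forall_fin_two (p := fun l => .inl (e, l) ∈ X).2 ((hedge e).1 he) l
      · exact (hvert v).2 hv
    · exact Bool.false_ne_true (old_mem_T6.1 ((hvert _).1 hq))
    · exact (hedge _).2 (notMem_F6_iff.2 ⟨_, rfl⟩)
    all_goals
      obtain ⟨u, -, hu⟩ := (hvert _).1 h
      cases hu
  · rintro ⟨hX, ⟨hvert, hxor⟩, hlayers⟩
    refine ⟨fun e => ⟨fun he => ⟨?_, ?_⟩, fun he => ?_⟩, fun v => ⟨fun hv => ?_, fun hv => ?_⟩⟩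
    · exact hX (inl_mem_certainEdges.2 he)
    · exact hX (inl_mem_certainEdges.2 he)
    · obtain ⟨f, rfl⟩ := notMem_F6_iff.1 he
      obtain ⟨j, rfl⟩ := cellEdge.surjective f
      exact hxor j
    · rcases v with u | f | f
      · obtain ⟨q | t, rfl⟩ := chainEquiv.surjective u
        exacts [absurd hv (hvert q), old_mem_T6.2 rfl]
      all_goals obtain ⟨j, rfl⟩ := cellEdge.surjective f
      exacts [absurd hv (hlayers j).1, absurd hv (hlayers j).2]
    · exact hX (inr_mem_certainEdges.2 hv)

theorem E6_prob_lt : (E6 D6 T6 F6).prob (.old 0, 0) (.old 9, 0) <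
    (E6 D6 T6 F6).prob (.old 0, 0) (.old 9, 1) := by
  have hbij : Set.BijOn digraphState (E6 D6 T6 F6).outcomes
      {s | ¬ s.Cut ∧ s.PreservesLayers} := by
    have houtcomes : (E6 D6 T6 F6).outcomes = {X | certainEdges T6 F6 ⊆ X} ∩
        digraphState ⁻¹' {s | ¬ s.Cut ∧ s.PreservesLayers} := Set.ext fun X => mem_E6_outcomes
    rw [houtcomes]
    exact bijOn_digraphState.subset_right (Set.subset_univ _)
  have hprob : ∀ i, (E6 D6 T6 F6).prob (.old 0, 0) (.old 9, i) =
      uniformProb {s | ¬ s.Cut ∧ s.PreservesLayers} (Hits · i) := fun i =>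
    uniformProb_eq_of_bijOn hbij fun X hX => conn_digraph_iff_hits (mem_E6_outcomes.1 hX).1 i
  rw [hprob, hprob]
  exact uniformProb_not_cut_hits_lt

end

/-! ### The directed multigraph `D7` -/

section

variable {V : Type} {D : Digraph V} {T : Set V} {F : Set (DEdge D)} {k : ℕ}

/-- The edges of the bunkbed of `attachGadgets D T F k`, with `Net.Edge` unfolded. -/
abbrev GadgetBEdge (D : Digraph V) (T : Set V) (F : Set (DEdge D)) (k : ℕ) : Type :=
  (GadgetEdge D T F k × Fin 2) ⊕ GadgetVertex T k

/-- The edge of the bunkbed of `attachGadgets D T F k` that comes from an edge of the bunkbed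
of `D`. -/
def gadgetCoreEdge (k : ℕ) : ↥(certainEdges T F)ᶜ → GadgetBEdge D T F k
  | ⟨.inl (e, l), h⟩ => .inl (.inl (.inl ⟨e, mt inl_mem_certainEdges.2 h⟩), l)
  | ⟨.inr v, _⟩ => .inr (.inl v)

/-- The sets of edges of the gadgets that take the place of a certain edge: the parallel edges, and
the edges at the pendant vertices. -/
def gadgetBlock : (F × Fin 2) ⊕ T → Fin k → Set (GadgetBEdge D T F k)
  | .inl (e, l), j => {.inl (.inl (.inr (e, j)), l)}
  | .inr t, j => {.inl (.inr (.inl (t, j)), 0), .inl (.inr (.inl (t, j)), 1),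
      .inl (.inr (.inr (t, j)), 0), .inl (.inr (.inr (t, j)), 1), .inr (.inr (t, j))}

theorem injective_gadgetCoreEdge :
    Function.Injective (gadgetCoreEdge k : ↥(certainEdges T F)ᶜ → _) := by
  rintro ⟨⟨e, l⟩ | v, _⟩ ⟨⟨e', l'⟩ | v', _⟩ h
  · simpa [gadgetCoreEdge] using h
  · simp [gadgetCoreEdge] at h
  · simp [gadgetCoreEdge] at h
  · simpa [gadgetCoreEdge] using h

theorem disjoint_gadgetBlock (b : (F × Fin 2) ⊕ T) :
    Pairwise fun i j : Fin k => Disjoint (gadgetBlock b i) (gadgetBlock b j) := by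
  intro i j hij
  rcases b with ⟨e, l⟩ | t
  · simp [gadgetBlock, hij]
  · simp [gadgetBlock, hij.symm]

theorem disjoint_range_gadgetCoreEdge_gadgetBlock (b : (F × Fin 2) ⊕ T) (j : Fin k) :
    Disjoint (Set.range (gadgetCoreEdge k)) (gadgetBlock b j) := by
  rw [Set.disjoint_left]
  rintro _ ⟨⟨⟨e, l⟩ | v, _⟩, rfl⟩ h <;> rcases b with ⟨e, l⟩ | t <;>
    simp [gadgetCoreEdge, gadgetBlock] at h

theorem ncard_gadgetBlock_inl (p : F × Fin 2) (j : Fin k) :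
    (gadgetBlock (T := T) (.inl p) j).ncard = 1 :=
  Set.ncard_singleton _

theorem ncard_gadgetBlock_inr (t : T) (j : Fin k) :
    (gadgetBlock (F := F) (.inr t) j).ncard = 5 := by
  simp [gadgetBlock, Set.ncard_insert_of_notMem]

/-- Contract the pendant edges. -/
def contractGadgets : GadgetVertex T k → V := Sum.elim id (·.1.1)

variable {X : Set (GadgetBEdge D T F k)}

theorem conn_gadget_of_containsBlocks (hX : ContainsBlocks gadgetBlock X) (t : T) (l m : Fin 2) :
    Conn (bunkbed (ofMultiDigraph (attachGadgets D T F k))) X (.inl t.1, l) (.inl t.1, m) := by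
  obtain ⟨j, hj⟩ := hX (.inr t)
  have hto : ∀ l, .inl (.inr (.inl (t, j)), l) ∈ X := by
    rw [Fin.forall_fin_two]
    exact ⟨hj (by simp [gadgetBlock]), hj (by simp [gadgetBlock])⟩
  have hfrom : ∀ l, .inl (.inr (.inr (t, j)), l) ∈ X := by
    rw [Fin.forall_fin_two]
    exact ⟨hj (by simp [gadgetBlock]), hj (by simp [gadgetBlock])⟩
  have hvert : Conn (bunkbed (ofMultiDigraph (attachGadgets D T F k))) X (.inr (t, j), l)
      (.inr (t, j), m) := conn_bunkbed_of_vertical (hj (.inr (.inr (.inr (.inr rfl))))) l m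
  exact .head (step_bunkbed_of_joins (hto l) ⟨rfl, rfl⟩)
    (hvert.tail (step_bunkbed_of_joins (hfrom m) ⟨rfl, rfl⟩))

theorem conn_attachGadgets_iff (hX : ContainsBlocks gadgetBlock X) {u v : V} {l m : Fin 2} :
    Conn (bunkbed (ofMultiDigraph (attachGadgets D T F k))) X (.inl u, l) (.inl v, m) ↔
      Conn (bunkbed (ofDigraph D)) (trace (gadgetCoreEdge k) X) (u, l) (v, m) := by
  refine reflTransGen_iff_of_retraction (f := Prod.map Sum.inl id)
    (g := Prod.map contractGadgets id) (fun _ => rfl) ?_ ?_ (a := (u, l)) (b := (v, m))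
  · rintro ⟨v, l⟩ ⟨w, m⟩ h
    rcases step_bunkbed.1 h with ⟨rfl, ⟨_, hadj⟩, he, rfl⟩ | ⟨rfl, -, hv⟩
    · refine .single ?_
      by_cases hF : ⟨(v, w), hadj⟩ ∈ F
      · obtain ⟨j, hj⟩ := hX (.inl (⟨_, hF⟩, l))
        exact step_bunkbed_of_joins (hj rfl) ⟨rfl, rfl⟩
      · exact step_bunkbed_of_joins (mem_trace.1 he (mt inl_mem_certainEdges.1 hF)) ⟨rfl, rfl⟩
    · by_cases hT : v ∈ T
      · exact conn_gadget_of_containsBlocks hX ⟨v, hT⟩ l m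
      · exact conn_bunkbed_of_vertical (mem_trace.1 hv (mt inr_mem_certainEdges.1 hT)) l m
  · rintro ⟨x, l⟩ ⟨y, m⟩ h
    rcases step_bunkbed.1 h with ⟨rfl, (e | ⟨e, j⟩) | (p | p), he, rfl, rfl⟩ | ⟨rfl, -, hx⟩
    · exact .single (step_bunkbed_of_joins (e := e.1) (mem_trace.2 fun _ => he) rfl)
    · exact .single (step_bunkbed_of_joins (e := e.1)
        (subset_trace _ _ (inl_mem_certainEdges.2 e.2)) rfl)
    · exact .refl
    · exact .refl
    · refine conn_bunkbed_of_vertical ?_ l m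
      rcases x with v | p
      exacts [mem_trace.2 fun _ => hx, subset_trace _ _ (inr_mem_certainEdges.2 p.1.2)]

end

section

open ChainState

/-- The vertices of `D6` are those of `H4` and two for each hyperedge. -/
def d6VertexEquiv : D6Vertex ≃ Fin 10 ⊕ H4.edgeSet ⊕ H4.edgeSet where
  toFun | .old u => .inl u | .x f => .inr (.inl f) | .y f => .inr (.inr f)
  invFun | .inl u => .old u | .inr (.inl f) => .x f | .inr (.inr f) => .y f
  left_inv := by rintro (_ | _ | _) <;> rfl
  right_inv := by rintro (_ | _ | _) <;> rfl

instance : Finite D6Vertex := .of_equiv _ d6VertexEquiv.symm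

theorem nat_card_D6Vertex : Nat.card D6Vertex = 22 := by
  rw [Nat.card_congr d6VertexEquiv, Nat.card_sum, Nat.card_sum, ← Nat.card_congr cellEdge,
    Nat.card_fin, Nat.card_fin]

theorem nat_card_T6 : Nat.card T6 = 3 := by
  rw [T6, Nat.card_image_of_injective (fun _ _ h => D6Vertex.old.inj h), nat_card_T4]

theorem nat_card_D7_vertex : Nat.card (GadgetVertex T6 690) = 2092 := by
  rw [Nat.card_sum, Nat.card_prod, nat_card_T6, nat_card_D6Vertex, Nat.card_fin]

theorem nat_card_F6_le : Nat.card F6 ≤ 22 * 22 := by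
  rw [← nat_card_D6Vertex, ← Nat.card_prod]
  exact Nat.card_le_card_of_injective (·.1.1) (Subtype.val_injective.comp Subtype.val_injective)

set_option exponentiation.threshold 1000 in
theorem E7_prob_lt : (E7 D7).prob (.inl (.old 0), 0) (.inl (.old 9), 0) <
    (E7 D7).prob (.inl (.old 0), 0) (.inl (.old 9), 1) := by
  have := Fintype.ofFinite T6
  have := Fintype.ofFinite F6
  have hT : Fintype.card T6 = 3 := by rw [← Nat.card_eq_fintype_card, nat_card_T6]
  have hF : (Fintype.card F6 : ℚ) ≤ 484 := by
    rw [← Nat.card_eq_fintype_card]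
    exact_mod_cast nat_card_F6_le
  have hprob : ∀ i, uniformProb {Y | certainEdges T6 F6 ⊆ Y}
      (fun Y => Conn (bunkbed (ofDigraph D6)) Y (.old 0, 0) (.old 9, i)) =
        uniformProb Set.univ (Hits · i) := fun i =>
    uniformProb_eq_of_bijOn bijOn_digraphState fun X hX => conn_digraph_iff_hits hX i
  refine randomSetProb_lt_of_blocks (injective_gadgetCoreEdge (k := 690)) disjoint_gadgetBlock
    disjoint_range_gadgetCoreEdge_gadgetBlock
    (R₀ := fun Y => Conn (bunkbed (ofDigraph D6)) Y (.old 0, 0) (.old 9, 0))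
    (R₁ := fun Y => Conn (bunkbed (ofDigraph D6)) Y (.old 0, 0) (.old 9, 1))
    (fun _ hX => conn_attachGadgets_iff hX) (fun _ hX => conn_attachGadgets_iff hX)
    (d := 4 / 2 ^ 31) (by positivity) ?_ ?_
  · rw [hprob, hprob]
    exact uniformProb_hits_add_le
  · simp only [Fintype.sum_sum_type, ncard_gadgetBlock_inl, ncard_gadgetBlock_inr,
      Finset.prod_const, Finset.sum_const, Finset.card_univ, Fintype.card_prod, Fintype.card_fin,
      hT, nsmul_eq_mul]
    calc _ ≤ (484 * 2 * (1 - (1 / 2) ^ 1) ^ 690 + 3 * (1 - (1 / 2) ^ 5) ^ 690) *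
          (1 + 4 / 2 ^ 31 : ℚ) := by
            push_cast
            gcongr
      _ < _ := by norm_num

end

/-! ### The graph `G2` -/

section

open ChainState

/-- The vertices of `G2` outside `T2`, in the order of the cells of the chain. -/
def siteCell : Fin 6 → Fin 9 := ![0, 4, 3, 2, 5, 8]

/-- The vertices in `T2`, in the order of the posts of the chain. -/
def sitePost : Fin 3 → Fin 9 := ![1, 7, 6]

/-- The vertex `x` of `G2` stands for a cell that contains `v`, or for `v` itself, which is then a
post. -/
def SiteMem (x : Fin 9) (v : ChainVertex) : Prop :=
  (∃ j, x = siteCell j ∧ ChainMem j v) ∨ ∃ t, x = sitePost t ∧ v = .inr t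

instance (x : Fin 9) (v : ChainVertex) : Decidable (SiteMem x v) := by
  unfold SiteMem; infer_instance

theorem siteCell_injective : Function.Injective siteCell := by
  unfold Function.Injective; decide

theorem notMem_T2_iff {x : Fin 9} : x ∉ T2 ↔ ∃ j, x = siteCell j := by
  simp only [T2, Set.mem_insert_iff, Set.mem_singleton_iff]
  revert x; decide

theorem mem_T2_iff {x : Fin 9} : x ∈ T2 ↔ ∃ t, x = sitePost t := by
  simp only [T2, Set.mem_insert_iff, Set.mem_singleton_iff]
  revert x; decide

theorem siteMem_siteCell {j : Fin 6} {v : ChainVertex} :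
    SiteMem (siteCell j) v ↔ ChainMem j v := by
  revert j v; decide

theorem siteMem_sitePost {t : Fin 3} {v : ChainVertex} :
    SiteMem (sitePost t) v ↔ v = .inr t := by
  revert t v; decide

theorem exists_siteMem_inr (x : Fin 9) : ∃ t, SiteMem x (.inr t) := by
  revert x; decide

theorem eq_zero_of_siteMem {x : Fin 9} (h : SiteMem x (.inl 0)) : x = 0 := by
  revert x; decide

theorem eq_eight_of_siteMem {x : Fin 9} (h : SiteMem x (.inl 6)) : x = 8 := by
  revert x; decide

theorem exists_siteMem_of_adj {x y : Fin 9} (h : G2.Adj x y) :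
    ∃ v, SiteMem x v ∧ SiteMem y v := by
  simp only [G2, SimpleGraph.fromEdgeSet_adj, Set.mem_insert_iff, Set.mem_singleton_iff] at h
  revert x y; decide

theorem eq_or_adj_of_siteMem_inl {x y : Fin 9} {q : Fin 7} (hx : SiteMem x (.inl q))
    (hy : SiteMem y (.inl q)) : x = y ∨ G2.Adj x y := by
  simp only [G2, SimpleGraph.fromEdgeSet_adj, Set.mem_insert_iff, Set.mem_singleton_iff]
  revert x y q; decide

theorem eq_or_adj_of_siteMem_inr {x : Fin 9} {t : Fin 3} (hx : SiteMem x (.inr t)) :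
    x = sitePost t ∨ G2.Adj x (sitePost t) := by
  simp only [G2, SimpleGraph.fromEdgeSet_adj, Set.mem_insert_iff, Set.mem_singleton_iff]
  revert x t; decide

/-- The state of the chain that describes a set of open vertices of the bunkbed of `G2`. -/
def siteState (W : Set (Fin 9 × Fin 2)) : ChainState where
  middle j l := (siteCell j, l) ∈ W
  entry _ := False
  exit _ := False
  vert _ := False

variable {W : Set (Fin 9 × Fin 2)} {x y : Fin 9} {v w : ChainVertex} {l m : Fin 2}

theorem preservesLayers_siteState : (siteState W).PreservesLayers := fun _ => ⟨id, id⟩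

theorem reach_siteState (hx : (x, l) ∈ W) (hv : SiteMem x v) (hw : SiteMem x w) :
    (siteState W).Reach (v, l) (w, l) := by
  by_cases hT : x ∈ T2
  · obtain ⟨t, rfl⟩ := mem_T2_iff.1 hT
    rw [siteMem_sitePost.1 hv, siteMem_sitePost.1 hw]
    exact .refl
  · obtain ⟨j, rfl⟩ := notMem_T2_iff.1 hT
    exact .single (.inl ⟨j, siteMem_siteCell.1 hv, siteMem_siteCell.1 hw,
      preservesLayers_siteState.passes_iff.2 ⟨rfl, hx⟩⟩)

theorem reach_siteState_of_step {p : ChainVertex × Fin 2} {a b : Fin 9 × Fin 2}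
    (hab : Step (bunkbed (ofGraph G2)) (openEdges G2 W) a b)
    (ha : ∀ v, SiteMem a.1 v → (siteState W).Reach p (v, a.2)) :
    ∀ v, SiteMem b.1 v → (siteState W).Reach p (v, b.2) := by
  obtain ⟨x, l⟩ := a
  obtain ⟨y, m⟩ := b
  intro w hw
  obtain ⟨⟨-, hy⟩, ⟨rfl, hadj⟩ | ⟨rfl, -⟩⟩ := step_openEdges.1 hab
  · obtain ⟨v, hxv, hyv⟩ := exists_siteMem_of_adj hadj
    exact (ha v hxv).trans (reach_siteState hy hyv hw)
  · obtain ⟨t, ht⟩ := exists_siteMem_inr x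
    exact ((ha _ ht).tail (step_post _ t l m)).trans (reach_siteState hy ht hw)

theorem conn_openEdges_of_adj {V : Type} {G : SimpleGraph V} {W : Set (V × Fin 2)} {x y : V}
    {l : Fin 2} (hx : (x, l) ∈ W) (hy : (y, l) ∈ W) (h : x = y ∨ G.Adj x y) :
    Conn (bunkbed (ofGraph G)) (openEdges G W) (x, l) (y, l) := by
  obtain rfl | hadj := h
  exacts [.refl, .single (step_openEdges.2 ⟨⟨hx, hy⟩, .inl ⟨rfl, hadj⟩⟩)]

theorem conn_of_siteMem_inr (hW : Prod.fst ⁻¹' T2 ⊆ W) (hx : (x, l) ∈ W) {t : Fin 3}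
    (h : SiteMem x (.inr t)) :
    Conn (bunkbed (ofGraph G2)) (openEdges G2 W) (x, l) (sitePost t, m) := by
  have hpost : ∀ m, (sitePost t, m) ∈ W := fun m => hW (mem_T2_iff.2 ⟨t, rfl⟩)
  refine (conn_openEdges_of_adj hx (hpost l) (eq_or_adj_of_siteMem_inr h)).trans ?_
  obtain rfl | hlm := eq_or_ne l m
  exacts [.refl, .single (step_openEdges.2 ⟨⟨hpost l, hpost m⟩, .inr ⟨rfl, hlm⟩⟩)]

theorem conn_of_siteMem (hW : Prod.fst ⁻¹' T2 ⊆ W) (hx : (x, l) ∈ W) (hy : (y, l) ∈ W)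
    (hxv : SiteMem x v) (hyv : SiteMem y v) :
    Conn (bunkbed (ofGraph G2)) (openEdges G2 W) (x, l) (y, l) := by
  rcases v with q | t
  · exact conn_openEdges_of_adj hx hy (eq_or_adj_of_siteMem_inl hxv hyv)
  · exact (conn_of_siteMem_inr hW hx hxv).trans (conn_openEdges_of_adj
      (hW (mem_T2_iff.2 ⟨t, rfl⟩)) hy ((eq_or_adj_of_siteMem_inr hyv).imp Eq.symm .symm))

/-- What reachability of a vertex of the chain means for the bunkbed of `G2`: unless it is the
starting point, it is contained in an open site which is reached. -/
def SiteReaches (W : Set (Fin 9 × Fin 2)) (p : ChainVertex × Fin 2) : Prop :=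
  p = (.inl 0, 0) ∨ ∃ x, SiteMem x p.1 ∧ (x, p.2) ∈ W ∧
    Conn (bunkbed (ofGraph G2)) (openEdges G2 W) (0, 0) (x, p.2)

theorem siteReaches_of_step (hW : Prod.fst ⁻¹' T2 ⊆ W) {p q : ChainVertex × Fin 2}
    (hpq : (siteState W).Step p q) (hp : SiteReaches W p) : SiteReaches W q := by
  obtain ⟨v, l⟩ := p
  obtain ⟨w, m⟩ := q
  rcases hpq with ⟨j, hv, hw, hpass⟩ | ⟨rfl : v = w, hv⟩
  · obtain ⟨rfl : l = m, hj⟩ := preservesLayers_siteState.passes_iff.1 hpass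
    refine .inr ⟨siteCell j, siteMem_siteCell.2 hw, hj, ?_⟩
    obtain h | ⟨x, hx, hxW, hconn⟩ := hp
    · obtain ⟨rfl, rfl⟩ := Prod.mk.inj h
      rw [eq_zero_of_siteMem (siteMem_siteCell.2 hv)]
      exact .refl
    · exact hconn.trans (conn_of_siteMem hW hxW hj hx (siteMem_siteCell.2 hv))
  · rcases v with q | t
    · exact hv.elim
    · obtain h | ⟨x, hx, hxW, hconn⟩ := hp
      · cases (Prod.mk.inj h).1
      · exact .inr ⟨sitePost t, siteMem_sitePost.2 rfl, hW (mem_T2_iff.2 ⟨t, rfl⟩),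
          hconn.trans (conn_of_siteMem_inr hW hxW hx)⟩

theorem conn_site_iff_hits (hW : Prod.fst ⁻¹' T2 ⊆ W) (i : Fin 2) :
    Conn (bunkbed (ofGraph G2)) (openEdges G2 W) (0, 0) (8, i) ↔ (siteState W).Hits i := by
  constructor
  · intro h
    have hopen : ((0, 0) : Fin 9 × Fin 2) ∈ W := by
      obtain h | ⟨⟨y, m⟩, hstep, -⟩ := h.cases_head
      · cases (Prod.mk.inj h).1
      · exact (step_openEdges.1 hstep).1.1
    exact reflTransGen_preserves
      (P := fun a => ∀ v, SiteMem a.1 v → (siteState W).Reach (.inl 0, 0) (v, a.2))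
      (fun _ _ => reach_siteState_of_step) h
      (fun _ => reach_siteState hopen (siteMem_siteCell (j := 0).2 (.inl rfl)))
      _ (siteMem_siteCell (j := 5).2 (.inr (.inl rfl)))
  · intro h
    obtain h | ⟨x, hx, -, hconn⟩ : SiteReaches W (.inl 6, i) :=
      reflTransGen_preserves (P := SiteReaches W) (fun _ _ => siteReaches_of_step hW) h (.inl rfl)
    · cases (Prod.mk.inj h).1
    · rwa [eq_eight_of_siteMem hx] at hconn

theorem bijOn_siteState : Set.BijOn siteState {W | Prod.fst ⁻¹' T2 ⊆ W}
    {s | s.PreservesLayers ∧ ∀ q, ¬ s.vert q} := by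
  refine ⟨fun W _ => ⟨preservesLayers_siteState, fun _ => id⟩, fun W hW W' hW' h => ?_,
    fun s ⟨hs, hvert⟩ => ?_⟩
  · ext ⟨x, l⟩
    by_cases hx : x ∈ T2
    · exact iff_of_true (hW hx) (hW' hx)
    · obtain ⟨j, rfl⟩ := notMem_T2_iff.1 hx
      exact iff_of_eq (congrFun₂ (congrArg middle h) j l)
  · refine ⟨{p | ∀ j, p.1 = siteCell j → s.middle j p.2},
      fun p hp j hj => absurd hp (notMem_T2_iff.2 ⟨j, hj⟩), ?_⟩
    ext <;> simp [siteState, siteCell_injective.eq_iff, (hs _).1, (hs _).2, hvert]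

theorem mem_E2_outcomes :
    W ∈ (E2 G2 T2).outcomes ↔
      Prod.fst ⁻¹' T2 ⊆ W ∧ ¬ (siteState W).Cut ∧ (siteState W).PreservesLayers := by
  rw [and_iff_left preservesLayers_siteState, not_cut_iff]
  constructor
  · intro h
    exact ⟨fun p hp => Fin.forall_fin_two (p := fun l => (p.1, l) ∈ W).2 ((h p.1).1 hp) p.2,
      fun _ => id, fun j => (h _).2 (notMem_T2_iff.2 ⟨j, rfl⟩)⟩
  · rintro ⟨hW, -, hxor⟩ x
    refine ⟨fun hx => ⟨hW hx, hW hx⟩, fun hx => ?_⟩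
    obtain ⟨j, rfl⟩ := notMem_T2_iff.1 hx
    exact hxor j

theorem E2_prob_lt : (E2 G2 T2).prob (0, 0) (8, 0) < (E2 G2 T2).prob (0, 0) (8, 1) := by
  have hbij : Set.BijOn siteState (E2 G2 T2).outcomes {s | ¬ s.Cut ∧ s.PreservesLayers} := by
    have houtcomes : (E2 G2 T2).outcomes = {W | Prod.fst ⁻¹' T2 ⊆ W} ∩
        siteState ⁻¹' {s | ¬ s.Cut ∧ s.PreservesLayers} := Set.ext fun W => mem_E2_outcomes
    rw [houtcomes]
    exact bijOn_siteState.subset_right fun s hs => ⟨hs.2, (not_cut_iff.1 hs.1).1⟩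
  have hprob : ∀ i, (E2 G2 T2).prob (0, 0) (8, i) =
      uniformProb {s | ¬ s.Cut ∧ s.PreservesLayers} (Hits · i) := fun i =>
    uniformProb_eq_of_bijOn hbij fun W hW => conn_site_iff_hits (mem_E2_outcomes.1 hW).1 i
  rw [hprob, hprob]
  exact uniformProb_not_cut_hits_lt

end

/-! ### Blow-ups and the graph `G1` -/

section

variable {V : Type} {G : SimpleGraph V} {T : Set V} {k : ℕ}

/-- The copy in the bunkbed of the blow-up of a vertex which is not blown up. -/
def blowUpCore (k : ℕ) : ↥(Prod.fst ⁻¹' T : Set (V × Fin 2))ᶜ → BlowUpVertex T k × Fin 2 :=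
  fun p => (.inl ⟨p.1.1, p.2⟩, p.1.2)

/-- Both copies of the `j`-th vertex in the blow-up of `t`. -/
def blowUpBlock (t : T) (j : Fin k) : Set (BlowUpVertex T k × Fin 2) :=
  {(.inr (t, j), 0), (.inr (t, j), 1)}

open Classical in
/-- The embedding of `V` into the blow-up that selects the `c t`-th vertex in the blow-up of
`t`. -/
noncomputable def blowUpSection (c : T → Fin k) (v : V) : BlowUpVertex T k :=
  if h : v ∈ T then .inr (⟨v, h⟩, c ⟨v, h⟩) else .inl ⟨v, h⟩

theorem injective_blowUpCore :
    Function.Injective (blowUpCore k : ↥(Prod.fst ⁻¹' T : Set (V × Fin 2))ᶜ → _) := by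
  rintro ⟨⟨x, l⟩, _⟩ ⟨⟨y, m⟩, _⟩ h
  simpa [blowUpCore] using h

theorem disjoint_blowUpBlock (t : T) :
    Pairwise fun i j : Fin k => Disjoint (blowUpBlock t i) (blowUpBlock t j) := fun i j hij => by
  simp [blowUpBlock, hij.symm]

theorem disjoint_range_blowUpCore_blowUpBlock (t : T) (j : Fin k) :
    Disjoint (Set.range (blowUpCore k)) (blowUpBlock t j) := by
  rw [Set.disjoint_left]
  rintro _ ⟨p, rfl⟩ h
  simp [blowUpCore, blowUpBlock] at h

theorem ncard_blowUpBlock (t : T) (j : Fin k) : (blowUpBlock t j).ncard = 2 :=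
  Set.ncard_pair (by simp)

theorem blowUpProj_blowUpSection (c : T → Fin k) (v : V) :
    blowUpProj T k (blowUpSection c v) = v := by
  unfold blowUpSection
  split <;> rfl

theorem blowUpSection_coe (c : T → Fin k) (v : ↥Tᶜ) : blowUpSection c v.1 = .inl v :=
  dif_neg v.2

theorem conn_blowUp_iff {W : Set (BlowUpVertex T k × Fin 2)} (hW : ContainsBlocks blowUpBlock W)
    {u v : ↥Tᶜ} {l m : Fin 2} :
    Conn (bunkbed (ofGraph (blowUp G T k))) (openEdges (blowUp G T k) W) (.inl u, l) (.inl v, m) ↔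
      Conn (bunkbed (ofGraph G)) (openEdges G (trace (blowUpCore k) W)) (u.1, l) (v.1, m) := by
  choose c hc using hW
  rw [← blowUpSection_coe c u, ← blowUpSection_coe c v]
  have hsection : ∀ {x l}, (x, l) ∈ trace (blowUpCore k) W → (blowUpSection c x, l) ∈ W := by
    intro x l h
    by_cases hx : x ∈ T
    · rw [blowUpSection, dif_pos hx]
      exact hc ⟨x, hx⟩ (by simpa [blowUpBlock] using Fin.exists_fin_two.1 ⟨l, rfl⟩)
    · rw [blowUpSection, dif_neg hx]
      exact mem_trace.1 h hx
  have hproj : ∀ {z l}, (z, l) ∈ W → (blowUpProj T k z, l) ∈ trace (blowUpCore k) W := by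
    rintro (z | p) l h
    exacts [mem_trace.2 fun _ => h, subset_trace _ _ p.1.2]
  refine reflTransGen_iff_of_retraction (f := Prod.map (blowUpSection c) id)
    (g := Prod.map (blowUpProj T k) id) (fun p => Prod.ext (blowUpProj_blowUpSection c p.1) rfl)
    ?_ ?_ (a := (u.1, l)) (b := (v.1, m))
  · rintro ⟨x, l⟩ ⟨y, m⟩ h
    obtain ⟨⟨hx, hy⟩, h⟩ := step_openEdges.1 h
    refine .single (step_openEdges.2 ⟨⟨hsection hx, hsection hy⟩, ?_⟩)
    refine h.imp (And.imp_right fun hadj => ?_) (And.imp_left (congrArg _))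
    simpa only [blowUp, SimpleGraph.comap_adj, blowUpProj_blowUpSection] using hadj
  · rintro ⟨x, l⟩ ⟨y, m⟩ h
    obtain ⟨⟨hx, hy⟩, h⟩ := step_openEdges.1 h
    exact .single (step_openEdges.2
      ⟨⟨hproj hx, hproj hy⟩, h.imp_right (And.imp_left (congrArg _))⟩)

end

theorem nat_card_T2 : Nat.card T2 = 3 := by
  rw [Nat.card_coe_set_eq, T2, Set.ncard_eq_toFinset_card']
  rfl

theorem nat_card_G1_vertex : Nat.card (BlowUpVertex T2 33) = 105 := by
  have hcompl : Nat.card T2 + Nat.card ↥T2ᶜ = 9 :=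
    (Set.ncard_add_ncard_compl T2).trans (Nat.card_fin 9)
  rw [nat_card_T2] at hcompl
  rw [Nat.card_sum, Nat.card_prod, nat_card_T2, Nat.card_fin]
  lia

theorem E1_prob_lt : (E1 G1).prob (G1start, 0) (G1target, 0) <
    (E1 G1).prob (G1start, 0) (G1target, 1) := by
  have := Fintype.ofFinite T2
  have hcard : Fintype.card T2 = 3 := by rw [← Nat.card_eq_fintype_card, nat_card_T2]
  have hprob : ∀ i, uniformProb {Y | Prod.fst ⁻¹' T2 ⊆ Y}
      (fun Y => Conn (bunkbed (ofGraph G2)) (openEdges G2 Y) (0, 0) (8, i)) =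
        uniformProb {s | s.PreservesLayers ∧ ∀ q, ¬ s.vert q} (ChainState.Hits · i) := fun i =>
    uniformProb_eq_of_bijOn bijOn_siteState fun W hW => conn_site_iff_hits hW i
  refine randomSetProb_lt_of_blocks (injective_blowUpCore (k := 33)) disjoint_blowUpBlock
    disjoint_range_blowUpCore_blowUpBlock
    (R₀ := fun Y => Conn (bunkbed (ofGraph G2)) (openEdges G2 Y) (0, 0) (8, 0))
    (R₁ := fun Y => Conn (bunkbed (ofGraph G2)) (openEdges G2 Y) (0, 0) (8, 1))
    (fun _ hW => conn_blowUp_iff hW) (fun _ hW => conn_blowUp_iff hW)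
    (d := 1 / 2 ^ 12) (by positivity) ?_ ?_
  · rw [hprob, hprob]
    exact uniformProb_hits_add_le_of_preservesLayers_of_not_vert
  · simp only [ncard_blowUpBlock, Finset.prod_const, Finset.sum_const, Finset.card_univ, hcard,
      Fintype.card_fin]
    norm_num

end Bunkbed

theorem theorem1 :
    -- the generalised bunkbed conjecture is false for each of the models
    (¬ ∀ (V : Type) [Finite V] (G : SimpleGraph V),
        Bunkbed.BunkbedConjecture (Bunkbed.E1 G)) ∧
    (¬ ∀ (V : Type) [Finite V] (G : SimpleGraph V) (T : Set V),
        Bunkbed.BunkbedConjecture (Bunkbed.E2 G T)) ∧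
    (¬ ∀ (α : Type) [Finite α] (H : Hypergraph α) (T : Set H.vertexSet),
        Bunkbed.BunkbedConjecture (Bunkbed.E4 H T)) ∧
    (¬ ∀ (α : Type) [Finite α] (H : Hypergraph α),
        Bunkbed.BunkbedConjecture (Bunkbed.E5 H)) ∧
    (¬ ∀ (V : Type) [Finite V] (D : Digraph V) (T : Set V) (F : Set (Bunkbed.DEdge D)),
        Bunkbed.BunkbedConjecture (Bunkbed.E6 D T F)) ∧
    (¬ ∀ (V E : Type) [Finite V] [Finite E] (D : Bunkbed.MultiDigraph V E),
        Bunkbed.BunkbedConjecture (Bunkbed.E7 D)) ∧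
    -- the explicit counterexample for unconditioned site percolation
    (Nat.card (Bunkbed.BlowUpVertex Bunkbed.T2 33) = 105 ∧
      (Bunkbed.E1 Bunkbed.G1).prob (Bunkbed.G1start, 0) (Bunkbed.G1target, 0) <
        (Bunkbed.E1 Bunkbed.G1).prob (Bunkbed.G1start, 0) (Bunkbed.G1target, 1)) ∧
    -- the explicit counterexample for conditioned site percolation
    ((Bunkbed.E2 Bunkbed.G2 Bunkbed.T2).prob (0, 0) (8, 0) <
        (Bunkbed.E2 Bunkbed.G2 Bunkbed.T2).prob (0, 0) (8, 1)) ∧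
    -- the explicit counterexample for conditioned hypergraphs
    ((Bunkbed.E4 Bunkbed.H4 {v | v.1 ∈ Bunkbed.T4}).prob
          (Bunkbed.H4vertex 0, 0) (Bunkbed.H4vertex 9, 0) <
        (Bunkbed.E4 Bunkbed.H4 {v | v.1 ∈ Bunkbed.T4}).prob
          (Bunkbed.H4vertex 0, 0) (Bunkbed.H4vertex 9, 1)) ∧
    -- the explicit counterexample for unconditioned hypergraphs
    (Nat.card Bunkbed.H5.vertexSet = 316 ∧
      (Bunkbed.E5 Bunkbed.H5).prob (Bunkbed.H5vertex 0, 0) (Bunkbed.H5vertex 9, 0) <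
        (Bunkbed.E5 Bunkbed.H5).prob (Bunkbed.H5vertex 0, 0) (Bunkbed.H5vertex 9, 1)) ∧
    -- the explicit counterexample for conditioned digraphs
    ((Bunkbed.E6 Bunkbed.D6 Bunkbed.T6 Bunkbed.F6).prob
          (Bunkbed.D6Vertex.old 0, 0) (Bunkbed.D6Vertex.old 9, 0) <
        (Bunkbed.E6 Bunkbed.D6 Bunkbed.T6 Bunkbed.F6).prob
          (Bunkbed.D6Vertex.old 0, 0) (Bunkbed.D6Vertex.old 9, 1)) ∧
    -- the explicit counterexample for unconditioned directed multigraphs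
    (Nat.card (Bunkbed.GadgetVertex Bunkbed.T6 690) = 2092 ∧
      (Bunkbed.E7 Bunkbed.D7).prob
          (Sum.inl (Bunkbed.D6Vertex.old 0), 0) (Sum.inl (Bunkbed.D6Vertex.old 9), 0) <
        (Bunkbed.E7 Bunkbed.D7).prob
          (Sum.inl (Bunkbed.D6Vertex.old 0), 0) (Sum.inl (Bunkbed.D6Vertex.old 9), 1)) :=
  ⟨fun h => Bunkbed.not_bunkbedConjecture Bunkbed.E1_prob_lt (h _ _),
    fun h => Bunkbed.not_bunkbedConjecture Bunkbed.E2_prob_lt (h _ _ _),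
    fun h => Bunkbed.not_bunkbedConjecture Bunkbed.E4_prob_lt (h _ _ _),
    fun h => Bunkbed.not_bunkbedConjecture Bunkbed.E5_prob_lt (h _ _),
    fun h => Bunkbed.not_bunkbedConjecture Bunkbed.E6_prob_lt (h _ _ _ _),
    fun h => Bunkbed.not_bunkbedConjecture Bunkbed.E7_prob_lt (h _ _ _),
    ⟨Bunkbed.nat_card_G1_vertex, Bunkbed.E1_prob_lt⟩, Bunkbed.E2_prob_lt, Bunkbed.E4_prob_lt,
    ⟨Bunkbed.nat_card_H5_vertexSet, Bunkbed.E5_prob_lt⟩, Bunkbed.E6_prob_lt,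
    ⟨Bunkbed.nat_card_D7_vertex, Bunkbed.E7_prob_lt⟩⟩
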